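/- Let $K$ be a field of characteristic zero, $n\ge 0$ an integer, $P_n=K[x_1,\ldots,x_n]$, $\partial_i=\frac{\partial}{\partial x_i}$, and let $\int_i: P_n\to P_n$ be the $K$-linear map $x^\alpha\mapsto(\alpha_i+1)^{-1}x_ix^\alpha$. Put $H_i=\partial_ix_i$, an invertible element of $\mathrm{End}_K(P_n)$ (where $x_i$ denotes multiplication by $x_i$). Let $I_n$ be the $K$-subalgebra of $\mathrm{End}_K(P_n)$ generated by all $x_i,\partial_i,\int_i$ (the algebra of polynomial integro-differential operators), and let $A_n$ be the $K$-subalgebra generated by all $x_i,\partial_i,H_i^{-1}$ (the Jacobian algebra); then $I_n\subseteq A_n$, since $\int_i=x_iH_i^{-1}$. Let $e_{jj}(i)=\int_i^j\partial_i^j-\int_i^{j+1}\partial_i^{j+1}$, let $(H_i+a)_*=H_i+a$ for integers $a\ge0$ and $(H_i-j)_*=H_i-j+e_{j-1,j-1}(i)$ for integers $j\ge1$, and let $S\subseteq I_n$ be the multiplicative monoid generated by all $(H_i+a)_*$, $1\le i\le n$, $a\in\mathbb Z$. All automorphisms are $K$-algebra automorphisms. Then: 1. $A_n$ is the two-sided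 localization $S^{-1}I_n=I_nS^{-1}$ of $I_n$ at $S$. 2. Every automorphism of $I_n$ extends uniquely to an automorphism of $A_n$. 3. The map sending an automorphism of $I_n$ to its extension is an injective group homomorphism $\mathrm{Aut}(I_n)\to\mathrm{Aut}(A_n)$ with image $\{\sigma\in\mathrm{Aut}(A_n) : \sigma(I_n)=I_n\}$. In this sense $G_n:=\mathrm{Aut}(I_n)=\{\sigma\in \mathrm{Aut}(A_n):\sigma(I_n)=I_n\}$ is a subgroup of $\mathrm{Aut}(A_n)$. -/

import Mathlib

open MvPolynomial

namespace IntDiff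

noncomputable section

/-- The ring of all `K`-linear maps from the polynomial algebra `P_n = K[x_1, …, x_n]` to itself. -/
abbrev EndP (K : Type*) [Field K] (n : ℕ) : Type _ :=
  Module.End K (MvPolynomial (Fin n) K)

/-- Multiplication by the variable `x_i` on `P_n`. -/
def mulX (K : Type*) [Field K] (n : ℕ) (i : Fin n) : EndP K n :=
  LinearMap.mulLeft K (X i)

/-- The partial derivative `∂_i` on `P_n`. -/
def del (K : Type*) [Field K] (n : ℕ) (i : Fin n) : EndP K n :=
  (pderiv i : Derivation K (MvPolynomial (Fin n) K) (MvPolynomial (Fin n) K)).toLinearMap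

/-- The integration `∫_i`, i.e. the linear map `x^α ↦ (α_i + 1)⁻¹ x_i x^α` on `P_n`. -/
def integ (K : Type*) [Field K] (n : ℕ) (i : Fin n) : EndP K n :=
  (basisMonomials (Fin n) K).constr K
    fun α => ((α i : K) + 1)⁻¹ • (X i * monomial α (1 : K))

/-- The operator `H_i = ∂_i x_i`. -/
def opH (K : Type*) [Field K] (n : ℕ) (i : Fin n) : EndP K n :=
  del K n i * mulX K n i

/-- The linear map `x^α ↦ (α_i + 1)⁻¹ x^α` on `P_n`; in characteristic zero it is the
two-sided inverse of `H_i`, see `opH_mul_opHInv` and `opHInv_mul_opH`. -/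
def opHInv (K : Type*) [Field K] (n : ℕ) (i : Fin n) : EndP K n :=
  (basisMonomials (Fin n) K).constr K fun α => ((α i : K) + 1)⁻¹ • monomial α (1 : K)

/-- The algebra `I_n` of polynomial integro-differential operators. -/
def intDiffAlg (K : Type*) [Field K] (n : ℕ) : Subalgebra K (EndP K n) :=
  Algebra.adjoin K (Set.range (mulX K n) ∪ Set.range (del K n) ∪ Set.range (integ K n))

/-- The Jacobian algebra `A_n`, generated by the Weyl algebra and the `H_i⁻¹`. -/
def jacobianAlg (K : Type*) [Field K] (n : ℕ) : Subalgebra K (EndP K n) :=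
  Algebra.adjoin K (Set.range (mulX K n) ∪ Set.range (del K n) ∪ Set.range (opHInv K n))

theorem opH_monomial (K : Type*) [Field K] (n : ℕ) (i : Fin n) (α : Fin n →₀ ℕ) :
    opH K n i (monomial α 1) = ((α i : K) + 1) • monomial α (1 : K) := by
  have h : (X i : MvPolynomial (Fin n) K) * monomial α 1
      = monomial (α + Finsupp.single i 1) 1 := by
    rw [add_comm, X, monomial_mul, one_mul]
  have h2 : opH K n i (monomial α 1)
      = pderiv i ((X i : MvPolynomial (Fin n) K) * monomial α 1) := rfl
  rw [h2, h, pderiv_monomial]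
  simp [smul_monomial]

theorem opHInv_monomial (K : Type*) [Field K] (n : ℕ) (i : Fin n) (α : Fin n →₀ ℕ) :
    opHInv K n i (monomial α 1) = ((α i : K) + 1)⁻¹ • monomial α (1 : K) := by
  have h := (basisMonomials (Fin n) K).constr_basis K
    (fun α => ((α i : K) + 1)⁻¹ • monomial α (1 : K)) α
  rwa [coe_basisMonomials] at h

theorem integ_monomial (K : Type*) [Field K] (n : ℕ) (i : Fin n) (α : Fin n →₀ ℕ) :
    integ K n i (monomial α 1) = ((α i : K) + 1)⁻¹ • (X i * monomial α (1 : K)) := by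
  have h := (basisMonomials (Fin n) K).constr_basis K
    (fun α => ((α i : K) + 1)⁻¹ • (X i * monomial α (1 : K))) α
  rwa [coe_basisMonomials] at h

theorem opH_mul_opHInv (K : Type*) [Field K] [CharZero K] (n : ℕ) (i : Fin n) :
    opH K n i * opHInv K n i = 1 := by
  refine (basisMonomials (Fin n) K).ext fun α => ?_
  have h : ((α i : K) + 1) ≠ 0 := by exact_mod_cast Nat.succ_ne_zero (α i)
  rw [coe_basisMonomials, Module.End.mul_apply, opHInv_monomial, map_smul, opH_monomial,
    smul_smul, inv_mul_cancel₀ h, one_smul, Module.End.one_apply]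

theorem opHInv_mul_opH (K : Type*) [Field K] [CharZero K] (n : ℕ) (i : Fin n) :
    opHInv K n i * opH K n i = 1 := by
  refine (basisMonomials (Fin n) K).ext fun α => ?_
  have h : ((α i : K) + 1) ≠ 0 := by exact_mod_cast Nat.succ_ne_zero (α i)
  rw [coe_basisMonomials, Module.End.mul_apply, opH_monomial, map_smul, opHInv_monomial,
    smul_smul, mul_inv_cancel₀ h, one_smul, Module.End.one_apply]

theorem integ_eq (K : Type*) [Field K] (n : ℕ) (i : Fin n) :
    integ K n i = mulX K n i * opHInv K n i := by
  refine (basisMonomials (Fin n) K).ext fun α => ?_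
  rw [coe_basisMonomials, Module.End.mul_apply, opHInv_monomial, map_smul, integ_monomial]
  rfl

theorem intDiffAlg_le_jacobianAlg (K : Type*) [Field K] (n : ℕ) :
    intDiffAlg K n ≤ jacobianAlg K n := by
  refine Algebra.adjoin_le ?_
  rintro _ ((⟨i, rfl⟩ | ⟨i, rfl⟩) | ⟨i, rfl⟩)
  · exact Algebra.subset_adjoin (Or.inl (Or.inl ⟨i, rfl⟩))
  · exact Algebra.subset_adjoin (Or.inl (Or.inr ⟨i, rfl⟩))
  · rw [integ_eq]
    exact mul_mem (Algebra.subset_adjoin (Or.inl (Or.inl ⟨i, rfl⟩)))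
      (Algebra.subset_adjoin (Or.inr ⟨i, rfl⟩))

/-- The inclusion `I_n → A_n`. -/
def incl (K : Type*) [Field K] (n : ℕ) : intDiffAlg K n →ₐ[K] jacobianAlg K n :=
  Subalgebra.inclusion (intDiffAlg_le_jacobianAlg K n)

/-- The matrix units `e_{st}(i) = ∫_i^s ∂_i^t - ∫_i^{s+1} ∂_i^{t+1}`. -/
def matUnit (K : Type*) [Field K] (n : ℕ) (i : Fin n) (s t : ℕ) : EndP K n :=
  integ K n i ^ s * del K n i ^ t - integ K n i ^ (s + 1) * del K n i ^ (t + 1)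

/-- The element `(H_i + a)_*` for an integer `a`: it is `H_i + a` for `a ≥ 0`, and
`H_i - j + e_{j-1,j-1}(i)` for `a = -j < 0` (here `Int.negSucc k = -(k + 1)`, so `j = k + 1`). -/
def hStar (K : Type*) [Field K] (n : ℕ) (i : Fin n) : ℤ → EndP K n
  | Int.ofNat a => opH K n i + (a : EndP K n)
  | Int.negSucc k => opH K n i - ((k + 1 : ℕ) : EndP K n) + matUnit K n i k k

theorem hStar_mem (K : Type*) [Field K] (n : ℕ) (i : Fin n) (a : ℤ) :
    hStar K n i a ∈ intDiffAlg K n := by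
  have hx : mulX K n i ∈ intDiffAlg K n := Algebra.subset_adjoin (Or.inl (Or.inl ⟨i, rfl⟩))
  have hd : del K n i ∈ intDiffAlg K n := Algebra.subset_adjoin (Or.inl (Or.inr ⟨i, rfl⟩))
  have hi : integ K n i ∈ intDiffAlg K n := Algebra.subset_adjoin (Or.inr ⟨i, rfl⟩)
  cases a with
  | ofNat a => exact add_mem (mul_mem hd hx) (natCast_mem _ a)
  | negSucc k =>
    exact add_mem (sub_mem (mul_mem hd hx) (natCast_mem _ _))
      (sub_mem (mul_mem (pow_mem hi _) (pow_mem hd _))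
        (mul_mem (pow_mem hi _) (pow_mem hd _)))

/-- The multiplicative submonoid `S` of `I_n` generated by all `(H_i + a)_*`. -/
def monoidS (K : Type*) [Field K] (n : ℕ) : Submonoid (intDiffAlg K n) :=
  Submonoid.closure
    (Set.range fun p : Fin n × ℤ => (⟨hStar K n p.1 p.2, hStar_mem K n p.1 p.2⟩ : intDiffAlg K n))

/-- The ring homomorphism `f : R → Q` makes `Q` the two-sided ring of fractions
`S⁻¹R = RS⁻¹` of `R` at `S`. -/
structure IsTwoSidedLocalization {R Q : Type*} [Ring R] [Ring Q] (S : Submonoid R)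
    (f : R →+* Q) : Prop where
  isUnit : ∀ s ∈ S, IsUnit (f s)
  exists_left : ∀ q : Q, ∃ s ∈ S, ∃ r : R, f s * q = f r
  exists_right : ∀ q : Q, ∃ s ∈ S, ∃ r : R, q * f s = f r
  ker_left : ∀ r : R, f r = 0 ↔ ∃ s ∈ S, s * r = 0
  ker_right : ∀ r : R, f r = 0 ↔ ∃ s ∈ S, r * s = 0

end

end IntDiff

open MvPolynomial
namespace IntDiff
noncomputable section
open scoped Classical
set_option linter.unusedSectionVars false
set_option linter.unusedVariables false
set_option linter.unusedSimpArgs false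

/-! In the basis of divided powers `dp`, `∫_i` and `∂_i` are unit shifts. An element of `I_n` is a
finite sum of shifts whose coefficients are eventually polynomial functions of the exponent; for
`A_n` only the finiteness of the set of shifts is used.

Localization: elements of `S` are diagonal with nonzero eigenvalues, and their inverses lie in
`A_n`. Passing `(H_i + a)_*` across a shift only changes `a`, so the Ore conditions and the
existence of denominators follow by induction from the generators.

Extension: `P_n` is a simple `I_n`-module and `I_n` contains a rank-one idempotent, so every
automorphism is conjugation by a linear automorphism of `P_n` (`exists_conj`). It therefore extends
to an automorphism `Φ` of `End(P_n)`, and the point is that `Φ(H_i⁻¹)` lies in `A_n`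
(`Normalizes.opHInv_map_mem`). The elements of `I_n` vanishing on all monomials with large `k`-th
exponent form a prime ideal `p_k` (`exists_mul_mul_not_negOn`). The intersection of the `p_k`
consists of the finite-rank elements, which `Φ` preserves, so `Φ` permutes the `p_k`. If `Φ⁻¹` maps
`p_j` into `p_i`, then on each slice `γ j = M` the operator `Φ(H_i)` satisfies a monic polynomial,
in columns and in rows. Iterating a nonzero leading shift would contradict this
(`leading_shift_nonpos`), so `Φ(H_i)` is diagonal far from the walls. Its eigenvalue is a polynomial
in `γ j` alone, and `∂H - H∂ = ∂` together with integrality forces the form `γ j + b`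
(`Normalizes.exists_shift`). Hence the inverse of `(H_j + b - 1)_*` inverts `Φ(H_i)` on the right
far from the walls. `exists_right_inverse_step` corrects it one direction at a time inside `A_n`,
and the exact right inverse obtained must be `Φ(H_i⁻¹)`. -/

variable {K : Type*} [Field K] [CharZero K] {n : ℕ}

/-! ### Divided powers, their coordinates, and the generators as shifts -/

/-- The basis of divided powers `x^α / α!`. -/
def dpBasis (K : Type*) [Field K] [CharZero K] (n : ℕ) :
    Module.Basis (Fin n → ℕ) K (MvPolynomial (Fin n) K) :=
  ((basisMonomials (Fin n) K).reindex Finsupp.equivFunOnFinite).isUnitSMul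
    (w := fun α => (∏ i, ((α i).factorial : K))⁻¹) (fun α => by
      refine IsUnit.mk0 _ (inv_ne_zero (Finset.prod_ne_zero_iff.2 fun i _ => ?_))
      exact_mod_cast (α i).factorial_ne_zero)

/-- The divided power `x^γ / γ!`, read as `0` if `γ` has a negative entry. -/
def dp (K : Type*) [Field K] [CharZero K] (n : ℕ) (γ : Fin n → ℤ) : MvPolynomial (Fin n) K :=
  if 0 ≤ γ then dpBasis K n (fun i => (γ i).toNat) else 0

theorem dp_of_not_nonneg {γ : Fin n → ℤ} (h : ¬ 0 ≤ γ) : dp K n γ = 0 := if_neg h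

theorem dp_natCast (α : Fin n → ℕ) : dp K n (fun i => (α i : ℤ)) = dpBasis K n α := by
  have h : (0 : Fin n → ℤ) ≤ fun i => (α i : ℤ) := fun i => Int.natCast_nonneg _
  simp [dp, h]

theorem dp_eq_monomial (α : Fin n → ℕ) :
    dp K n (fun i => (α i : ℤ)) = (∏ i, ((α i).factorial : K))⁻¹ •
      monomial (Finsupp.equivFunOnFinite.symm α) (1 : K) := by
  rw [dp_natCast, dpBasis, Module.Basis.isUnitSMul_apply, Module.Basis.reindex_apply, coe_basisMonomials]

theorem exists_natCast_eq {γ : Fin n → ℤ} (h : 0 ≤ γ) :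
    ∃ α : Fin n → ℕ, γ = fun i => (α i : ℤ) :=
  ⟨fun i => (γ i).toNat, funext fun i => (Int.toNat_of_nonneg (h i)).symm⟩

theorem end_ext {a b : EndP K n} (h : ∀ γ, 0 ≤ γ → a (dp K n γ) = b (dp K n γ)) : a = b := by
  refine (dpBasis K n).ext fun α => ?_
  rw [← dp_natCast]
  exact h _ fun i => Int.natCast_nonneg _

/-- The coordinate at the divided power `x^γ / γ!`. -/
def cf (K : Type*) [Field K] [CharZero K] (n : ℕ) (γ : Fin n → ℤ) :
    Module.Dual K (MvPolynomial (Fin n) K) :=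
  if 0 ≤ γ then (dpBasis K n).coord (fun i => (γ i).toNat) else 0

theorem cf_of_not_nonneg {γ : Fin n → ℤ} (h : ¬ 0 ≤ γ) : cf K n γ = 0 := if_neg h

theorem cf_dp {γ δ : Fin n → ℤ} (hδ : 0 ≤ δ) : cf K n γ (dp K n δ) = if γ = δ then 1 else 0 := by
  obtain ⟨β, rfl⟩ := exists_natCast_eq hδ
  by_cases hγ : 0 ≤ γ
  · obtain ⟨α, rfl⟩ := exists_natCast_eq hγ
    rw [dp_natCast, cf, if_pos hγ]
    have : ((fun i => (α i : ℤ)) = fun i => (β i : ℤ)) ↔ β = α := by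
      simp [funext_iff, eq_comm]
    simp [this, Finsupp.single_apply]
  · rw [cf_of_not_nonneg hγ, if_neg]
    · rfl
    · rintro rfl; exact hγ hδ

theorem cf_dp_self {γ : Fin n → ℤ} (hγ : 0 ≤ γ) : cf K n γ (dp K n γ) = 1 := by
  rw [cf_dp hγ, if_pos rfl]

theorem dp_linearIndependent :
    LinearIndependent K fun γ : {γ : Fin n → ℤ // 0 ≤ γ} => dp K n γ := by
  rw [linearIndependent_iff']
  intro s g hg i hi
  have h := congrArg (cf K n i) hg
  rw [map_sum, map_zero, Finset.sum_eq_single_of_mem i hi] at h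
  · simpa [cf_dp_self i.2] using h
  · intro j _ hj
    rw [map_smul, cf_dp j.2, if_neg fun h => hj (Subtype.ext h.symm), smul_zero]

theorem cf_linearIndependent :
    LinearIndependent K fun γ : {γ : Fin n → ℤ // 0 ≤ γ} => cf K n γ := by
  rw [linearIndependent_iff']
  intro s g hg i hi
  have h := congrArg (fun f => f (dp K n i)) hg
  simp only [LinearMap.sum_apply, LinearMap.smul_apply, LinearMap.zero_apply] at h
  rw [Finset.sum_eq_single_of_mem i hi] at h
  · simpa [cf_dp_self i.2] using h
  · intro j _ hj
    rw [cf_dp i.2, if_neg fun h => hj (Subtype.ext h), smul_zero]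

theorem poly_ext {p q : MvPolynomial (Fin n) K} (h : ∀ γ, 0 ≤ γ → cf K n γ p = cf K n γ q) :
    p = q := by
  refine (dpBasis K n).ext_elem fun α => ?_
  have h0 : (0 : Fin n → ℤ) ≤ fun i => (α i : ℤ) := fun i => Int.natCast_nonneg _
  have := h _ h0
  simpa [cf, h0] using this

theorem dual_ext {f g : Module.Dual K (MvPolynomial (Fin n) K)}
    (h : ∀ γ, 0 ≤ γ → f (dp K n γ) = g (dp K n γ)) : f = g := by
  refine (dpBasis K n).ext fun α => ?_
  rw [← dp_natCast]
  exact h _ fun i => Int.natCast_nonneg _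

theorem add_single_natCast (α : Fin n → ℕ) (i : Fin n) :
    (fun k => (α k : ℤ)) + Pi.single i 1 = fun k => (((α + Pi.single i 1 : Fin n → ℕ) k : ℕ) : ℤ) := by
  funext k
  by_cases h : k = i
  · subst h; simp
  · simp [h]

theorem factorial_prod_add_single (α : Fin n → ℕ) (i : Fin n) :
    ∏ k, (((α + Pi.single i 1 : Fin n → ℕ) k).factorial : K)
      = ((α i : K) + 1) * ∏ k, ((α k).factorial : K) := by
  classical
  rw [← Finset.mul_prod_erase Finset.univ _ (Finset.mem_univ i),
    ← Finset.mul_prod_erase Finset.univ (fun k => ((α k).factorial : K)) (Finset.mem_univ i),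
    ← mul_assoc]
  congr 1
  · simp [Nat.factorial_succ]
  · refine Finset.prod_congr rfl fun k hk => ?_
    simp [Finset.ne_of_mem_erase hk]

theorem equivFun_symm_add_single (α : Fin n → ℕ) (i : Fin n) :
    (Finsupp.equivFunOnFinite.symm (α + Pi.single i 1) : Fin n →₀ ℕ)
      = Finsupp.equivFunOnFinite.symm α + Finsupp.single i 1 := by
  ext k
  by_cases h : k = i
  · subst h; simp
  · simp [h, Finsupp.single_apply, Ne.symm h]

theorem succ_ne_zero_of_nonneg {γ : Fin n → ℤ} (h : 0 ≤ γ) (i : Fin n) : ((γ i : K) + 1) ≠ 0 := by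
  have := h i
  simp only [Pi.zero_apply] at this
  exact_mod_cast (by omega : γ i + 1 ≠ 0)

theorem mulX_dp (i : Fin n) {γ : Fin n → ℤ} (h : 0 ≤ γ) :
    mulX K n i (dp K n γ) = ((γ i : K) + 1) • dp K n (γ + Pi.single i 1) := by
  have h1 := succ_ne_zero_of_nonneg (K := K) h i
  obtain ⟨α, rfl⟩ := exists_natCast_eq h
  simp only [Int.cast_natCast] at h1 ⊢
  rw [add_single_natCast, dp_eq_monomial, dp_eq_monomial, factorial_prod_add_single,
    equivFun_symm_add_single, smul_smul, mul_inv, ← mul_assoc, mul_inv_cancel₀ h1, one_mul, map_smul]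
  congr 1
  rw [mulX, LinearMap.mulLeft_apply, add_comm, X, monomial_mul, one_mul]

theorem opHInv_dp (i : Fin n) {γ : Fin n → ℤ} (h : 0 ≤ γ) :
    opHInv K n i (dp K n γ) = ((γ i : K) + 1)⁻¹ • dp K n γ := by
  obtain ⟨α, rfl⟩ := exists_natCast_eq h
  rw [dp_eq_monomial, map_smul, opHInv_monomial, smul_comm]
  simp

theorem opH_dp (i : Fin n) {γ : Fin n → ℤ} (h : 0 ≤ γ) :
    opH K n i (dp K n γ) = ((γ i : K) + 1) • dp K n γ := by
  obtain ⟨α, rfl⟩ := exists_natCast_eq h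
  rw [dp_eq_monomial, map_smul, opH_monomial, smul_comm]
  simp

/-- The factor `γ i + 1` of `mulX_dp` cancels the eigenvalue of `opHInv`; this is the reason for
normalizing by factorials. -/
theorem integ_dp (i : Fin n) {γ : Fin n → ℤ} (h : 0 ≤ γ) :
    integ K n i (dp K n γ) = dp K n (γ + Pi.single i 1) := by
  rw [integ_eq, Module.End.mul_apply, opHInv_dp i h, map_smul, mulX_dp i h, smul_smul,
    inv_mul_cancel₀ (succ_ne_zero_of_nonneg h i), one_smul]

theorem del_dp_add (i : Fin n) {γ : Fin n → ℤ} (h : 0 ≤ γ) :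
    del K n i (dp K n (γ + Pi.single i 1)) = dp K n γ := by
  have h1 := succ_ne_zero_of_nonneg (K := K) h i
  have h2 := opH_dp (K := K) i h
  rw [opH, Module.End.mul_apply, mulX_dp i h, map_smul] at h2
  exact smul_right_injective _ h1 h2

theorem del_dp (i : Fin n) {γ : Fin n → ℤ} (h : 0 ≤ γ) :
    del K n i (dp K n γ) = dp K n (γ - Pi.single i 1) := by
  by_cases h' : 0 ≤ γ - Pi.single i 1
  · have := del_dp_add (K := K) i h'
    rwa [sub_add_cancel] at this
  -- On the wall `γ i = 0` the shifted index leaves the cone, where `dp` is zero by convention, in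
  -- agreement with the derivative.
  · rw [dp_of_not_nonneg h']
    have hi : γ i = 0 := by
      by_contra hne
      apply h'
      intro k
      have := h k
      by_cases hk : k = i
      · subst hk
        simp only [Pi.zero_apply, Pi.sub_apply, Pi.single_eq_same] at *
        omega
      · simpa [hk] using this
    obtain ⟨α, rfl⟩ := exists_natCast_eq h
    have h0 : α i = 0 := Int.natCast_eq_zero.1 hi
    rw [dp_eq_monomial, map_smul]
    have : del K n i (monomial (Finsupp.equivFunOnFinite.symm α) (1 : K)) = 0 := by
      change pderiv i _ = 0
      rw [pderiv_monomial]
      simp [h0]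
    rw [this, smul_zero]

theorem integ_pow_dp (i : Fin n) (k : ℕ) {γ : Fin n → ℤ} (h : 0 ≤ γ) :
    (integ K n i ^ k) (dp K n γ) = dp K n (γ + Pi.single i (k : ℤ)) := by
  induction k with
  | zero => simp
  | succ k ih =>
    rw [pow_succ', Module.End.mul_apply, ih, integ_dp i, add_assoc, ← Pi.single_add]
    · push_cast; rfl
    · exact add_nonneg h (Pi.single_nonneg.2 (Int.natCast_nonneg k))

theorem del_pow_dp (i : Fin n) (k : ℕ) {γ : Fin n → ℤ} (h : 0 ≤ γ) :
    (del K n i ^ k) (dp K n γ) = dp K n (γ - Pi.single i (k : ℤ)) := by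
  induction k with
  | zero => simp
  | succ k ih =>
    rw [pow_succ', Module.End.mul_apply, ih]
    have e : γ - Pi.single i ((k + 1 : ℕ) : ℤ) = γ - Pi.single i (k : ℤ) - Pi.single i 1 := by
      rw [sub_sub, ← Pi.single_add]; push_cast; rfl
    rw [e]
    by_cases h' : 0 ≤ γ - Pi.single i (k : ℤ)
    · rw [del_dp i h']
    · rw [dp_of_not_nonneg h', map_zero, dp_of_not_nonneg]
      intro h2
      exact h' (h2.trans (sub_le_self _ (Pi.single_nonneg.2 zero_le_one)))

theorem sub_single_nonneg_iff {γ : Fin n → ℤ} (h : 0 ≤ γ) (i : Fin n) (k : ℤ) :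
    0 ≤ γ - Pi.single i k ↔ k ≤ γ i := by
  constructor
  · intro h'
    have := h' i
    simpa using this
  · intro hk l
    by_cases hl : l = i
    · subst hl; simpa using hk
    · simpa [hl] using h l

theorem integ_pow_del_pow_dp (i : Fin n) (s t : ℕ) {γ : Fin n → ℤ} (h : 0 ≤ γ) :
    (integ K n i ^ s * del K n i ^ t) (dp K n γ)
      = if (t : ℤ) ≤ γ i then dp K n (γ + Pi.single i ((s : ℤ) - t)) else 0 := by
  rw [Module.End.mul_apply, del_pow_dp i t h]
  split_ifs with ht
  · rw [integ_pow_dp i s ((sub_single_nonneg_iff h i _).2 ht), Pi.single_sub]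
    congr 1; abel
  · rw [dp_of_not_nonneg (mt (sub_single_nonneg_iff h i _).1 ht), map_zero]

/-- The projection `∫_i^N ∂_i^N` onto the span of the monomials with `i`-th exponent at least `N`. -/
def tail (K : Type*) [Field K] (n : ℕ) (i : Fin n) (N : ℕ) : EndP K n :=
  integ K n i ^ N * del K n i ^ N

theorem tail_dp (i : Fin n) (N : ℕ) {γ : Fin n → ℤ} (h : 0 ≤ γ) :
    tail K n i N (dp K n γ) = if (N : ℤ) ≤ γ i then dp K n γ else 0 := by
  rw [tail, integ_pow_del_pow_dp i N N h]
  simp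

/-- The two terms of `matUnit` shift by the same amount and are cut off at `t` and `t + 1`, so they
differ only at exponent `t`. -/
theorem matUnit_dp (i : Fin n) (s t : ℕ) {γ : Fin n → ℤ} (h : 0 ≤ γ) :
    matUnit K n i s t (dp K n γ) = if γ i = t then dp K n (Function.update γ i (s : ℤ)) else 0 := by
  rw [matUnit, LinearMap.sub_apply, integ_pow_del_pow_dp i s t h, integ_pow_del_pow_dp i _ _ h]
  push_cast
  have e : (s : ℤ) + 1 - (t + 1) = s - t := by ring
  rw [e]
  rcases lt_trichotomy (γ i) t with hlt | heq | hgt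
  · rw [if_neg (by omega), if_neg (by omega), if_neg (by omega), sub_zero]
  · rw [if_pos (by omega), if_neg (by omega), if_pos heq, sub_zero]
    congr 1
    funext k
    by_cases hk : k = i
    · subst hk; simp [heq]
    · simp [hk]
  · rw [if_pos (by omega), if_pos (by omega), if_neg (by omega), sub_self]

theorem mulX_mem (i : Fin n) : mulX K n i ∈ intDiffAlg K n :=
  Algebra.subset_adjoin (Or.inl (Or.inl ⟨i, rfl⟩))

theorem del_mem (i : Fin n) : del K n i ∈ intDiffAlg K n :=
  Algebra.subset_adjoin (Or.inl (Or.inr ⟨i, rfl⟩))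

theorem integ_mem (i : Fin n) : integ K n i ∈ intDiffAlg K n :=
  Algebra.subset_adjoin (Or.inr ⟨i, rfl⟩)

theorem opH_mem (i : Fin n) : opH K n i ∈ intDiffAlg K n := mul_mem (del_mem i) (mulX_mem i)

theorem tail_mem (i : Fin n) (N : ℕ) : tail K n i N ∈ intDiffAlg K n :=
  mul_mem (pow_mem (integ_mem i) _) (pow_mem (del_mem i) _)

theorem matUnit_mem (i : Fin n) (s t : ℕ) : matUnit K n i s t ∈ intDiffAlg K n :=
  sub_mem (mul_mem (pow_mem (integ_mem i) _) (pow_mem (del_mem i) _))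
    (mul_mem (pow_mem (integ_mem i) _) (pow_mem (del_mem i) _))

theorem opHInv_mem (i : Fin n) : opHInv K n i ∈ jacobianAlg K n :=
  Algebra.subset_adjoin (Or.inr ⟨i, rfl⟩)

/-! ### Operators with finitely many shifts and their coefficient functions -/

/-- The operator `x^γ / γ! ↦ f(γ) x^(γ+β) / (γ+β)!`. -/
def shiftOp (β : Fin n → ℤ) (f : (Fin n → ℤ) → K) : EndP K n :=
  (dpBasis K n).constr K fun α =>
    f (fun i => (α i : ℤ)) • dp K n ((fun i => (α i : ℤ)) + β)

theorem shiftOp_dp (β : Fin n → ℤ) (f : (Fin n → ℤ) → K) {γ : Fin n → ℤ} (h : 0 ≤ γ) :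
    shiftOp β f (dp K n γ) = f γ • dp K n (γ + β) := by
  obtain ⟨α, rfl⟩ := exists_natCast_eq h
  rw [dp_natCast, shiftOp, Module.Basis.constr_basis]

/-- The truncation in the new coefficient records that the intermediate index must stay in the cone;
hence the form of `ShiftClosed`. -/
theorem shiftOp_mul (β δ : Fin n → ℤ) (f g : (Fin n → ℤ) → K) :
    shiftOp β f * shiftOp δ g
      = shiftOp (β + δ) ((fun γ => if 0 ≤ γ + δ then f (γ + δ) else 0) * g) := by
  refine end_ext fun γ h => ?_
  rw [Module.End.mul_apply, shiftOp_dp _ _ h, shiftOp_dp _ _ h, map_smul, Pi.mul_apply]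
  split_ifs with h'
  · rw [shiftOp_dp _ _ h', smul_smul, mul_comm, add_assoc, add_comm δ β]
  · rw [dp_of_not_nonneg h', map_zero, smul_zero, zero_mul, zero_smul]

/-- Subalgebras of functions on the lattice that are stable under truncated translation. -/
def ShiftClosed (D : Subalgebra K ((Fin n → ℤ) → K)) : Prop :=
  ∀ f ∈ D, ∀ δ : Fin n → ℤ, (fun γ => if 0 ≤ γ + δ then f (γ + δ) else 0) ∈ D

/-- The algebra of finite sums of operators `shiftOp β f` with coefficient functions in `D`. -/
def bandAlg (D : Subalgebra K ((Fin n → ℤ) → K)) (hD : ShiftClosed D) : Subalgebra K (EndP K n) where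
  carrier := Submodule.span K {a | ∃ β, ∃ f ∈ D, a = shiftOp β f}
  mul_mem' {a b} ha hb := by
    have h := Submodule.mul_mem_mul ha hb
    rw [Submodule.span_mul_span] at h
    refine Submodule.span_mono ?_ h
    rintro _ ⟨_, ⟨β, f, hf, rfl⟩, _, ⟨δ, g, hg, rfl⟩, rfl⟩
    exact ⟨β + δ, _, mul_mem (hD f hf δ) hg, shiftOp_mul _ _ _ _⟩
  add_mem' ha hb := add_mem ha hb
  algebraMap_mem' r := by
    refine Submodule.subset_span ⟨0, algebraMap K _ r, D.algebraMap_mem r, end_ext fun γ h => ?_⟩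
    rw [shiftOp_dp _ _ h, add_zero]
    rfl

theorem shiftOp_mem_bandAlg {D : Subalgebra K ((Fin n → ℤ) → K)} (hD : ShiftClosed D)
    (β : Fin n → ℤ) {f : (Fin n → ℤ) → K} (hf : f ∈ D) : shiftOp β f ∈ bandAlg D hD :=
  Submodule.subset_span ⟨β, f, hf, rfl⟩

theorem exists_band_rep {D : Subalgebra K ((Fin n → ℤ) → K)} {hD : ShiftClosed D} {a : EndP K n}
    (ha : a ∈ bandAlg D hD) :
    ∃ (B : Finset (Fin n → ℤ)) (f : (Fin n → ℤ) → (Fin n → ℤ) → K),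
      (∀ β, f β ∈ D) ∧ ∀ γ, 0 ≤ γ → a (dp K n γ) = ∑ β ∈ B, f β γ • dp K n (γ + β) := by
  -- The extra clause that `f β` vanishes off `B` allows two representations to be added over the
  -- union of their supports.
  have key : ∃ (B : Finset (Fin n → ℤ)) (f : (Fin n → ℤ) → (Fin n → ℤ) → K),
      (∀ β, f β ∈ D) ∧ (∀ β, β ∉ B → f β = 0) ∧
        ∀ γ, 0 ≤ γ → a (dp K n γ) = ∑ β ∈ B, f β γ • dp K n (γ + β) := by
    change a ∈ Submodule.span K _ at ha
    induction ha using Submodule.span_induction with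
    | mem x hx =>
      obtain ⟨β, f, hf, rfl⟩ := hx
      refine ⟨{β}, Pi.single β f, fun β' => ?_, fun β' hβ' => ?_, fun γ h => ?_⟩
      · by_cases h : β' = β
        · subst h; simpa using hf
        · rw [Pi.single_eq_of_ne h]; exact D.zero_mem
      · exact Pi.single_eq_of_ne (by simpa using hβ') _
      · simp [shiftOp_dp _ _ h]
    | zero => exact ⟨∅, 0, fun _ => D.zero_mem, fun _ _ => rfl, fun γ h => by simp⟩
    | add x y _ _ hx hy =>
      obtain ⟨B₁, f₁, h₁, z₁, e₁⟩ := hx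
      obtain ⟨B₂, f₂, h₂, z₂, e₂⟩ := hy
      refine ⟨B₁ ∪ B₂, f₁ + f₂, fun β => add_mem (h₁ β) (h₂ β), fun β hβ => ?_, fun γ h => ?_⟩
      · simp only [Finset.mem_union, not_or] at hβ
        simp [z₁ β hβ.1, z₂ β hβ.2]
      · rw [LinearMap.add_apply, e₁ γ h, e₂ γ h,
          Finset.sum_subset Finset.subset_union_left (fun β _ hβ => by simp [z₁ β hβ]),
          Finset.sum_subset (Finset.subset_union_right (s₁ := B₁) (s₂ := B₂)) (fun β _ hβ => by simp [z₂ β hβ]),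
          ← Finset.sum_add_distrib]
        exact Finset.sum_congr rfl fun β _ => by simp [add_smul]
    | smul c x _ hx =>
      obtain ⟨B, f, h, z, e⟩ := hx
      refine ⟨B, fun β => c • f β, fun β => D.smul_mem (h β) c, fun β hβ => by simp [z β hβ],
        fun γ hγ => ?_⟩
      rw [LinearMap.smul_apply, e γ hγ, Finset.smul_sum]
      exact Finset.sum_congr rfl fun β _ => by simp [mul_smul]
  obtain ⟨B, f, h, -, e⟩ := key
  exact ⟨B, f, h, e⟩

theorem exists_band_bound (B : Finset (Fin n → ℤ)) :
    ∃ C : ℕ, ∀ β ∈ B, ∀ i, -(C : ℤ) ≤ β i ∧ β i ≤ C := by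
  refine ⟨B.sup fun β => Finset.univ.sup fun i => (β i).natAbs, fun β hβ i => ?_⟩
  have h1 : (β i).natAbs ≤ Finset.univ.sup fun i => (β i).natAbs :=
    Finset.le_sup (f := fun i => (β i).natAbs) (Finset.mem_univ i)
  have h2 := Finset.le_sup (f := fun β : Fin n → ℤ => Finset.univ.sup fun i => (β i).natAbs) hβ
  exact ⟨by omega, by omega⟩

theorem shiftClosed_top : ShiftClosed (⊤ : Subalgebra K ((Fin n → ℤ) → K)) :=
  fun _ _ _ => Algebra.mem_top

/-- The function `f` is eventually polynomial along each axis, with a threshold independent of the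
other coordinates. -/
def AxisPoly (f : (Fin n → ℤ) → K) : Prop :=
  ∀ j, ∃ N : ℕ, ∀ α, ∃ q : Polynomial K, ∀ t : ℤ, (N : ℤ) ≤ t → f (Function.update α j t) = q.eval (t : K)

/-- The function `f` agrees with a polynomial at all points with large coordinates. -/
def CornerPoly (f : (Fin n → ℤ) → K) : Prop :=
  ∃ (N : ℕ) (p : MvPolynomial (Fin n) K), ∀ γ : Fin n → ℤ, (∀ i, (N : ℤ) ≤ γ i) →
    f γ = eval (fun i => (γ i : K)) p

/-- The algebra of eventually polynomial functions. -/
def evPoly (K : Type*) [Field K] [CharZero K] (n : ℕ) : Subalgebra K ((Fin n → ℤ) → K) where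
  carrier := {f | AxisPoly f ∧ CornerPoly f}
  mul_mem' := by
    rintro f g ⟨hf, N, p, hp⟩ ⟨hg, M, q, hq⟩
    refine ⟨fun j => ?_, max N M, p * q, fun γ h => ?_⟩
    · obtain ⟨N, hN⟩ := hf j
      obtain ⟨M, hM⟩ := hg j
      refine ⟨max N M, fun α => ?_⟩
      obtain ⟨p, hp⟩ := hN α
      obtain ⟨q, hq⟩ := hM α
      refine ⟨p * q, fun t ht => ?_⟩
      rw [Pi.mul_apply, hp t (by omega), hq t (by omega), Polynomial.eval_mul]
    · rw [Pi.mul_apply, hp γ fun i => by have := h i; omega, hq γ fun i => by have := h i; omega, map_mul]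
  add_mem' := by
    rintro f g ⟨hf, N, p, hp⟩ ⟨hg, M, q, hq⟩
    refine ⟨fun j => ?_, max N M, p + q, fun γ h => ?_⟩
    · obtain ⟨N, hN⟩ := hf j
      obtain ⟨M, hM⟩ := hg j
      refine ⟨max N M, fun α => ?_⟩
      obtain ⟨p, hp⟩ := hN α
      obtain ⟨q, hq⟩ := hM α
      refine ⟨p + q, fun t ht => ?_⟩
      rw [Pi.add_apply, hp t (by omega), hq t (by omega), Polynomial.eval_add]
    · rw [Pi.add_apply, hp γ fun i => by have := h i; omega, hq γ fun i => by have := h i; omega, map_add]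
  algebraMap_mem' r :=
    ⟨fun j => ⟨0, fun α => ⟨Polynomial.C r, fun t _ => by simp⟩⟩, 0, MvPolynomial.C r, fun γ _ => by simp⟩

theorem coord_mem_evPoly (i : Fin n) : (fun γ : Fin n → ℤ => (γ i : K)) ∈ evPoly K n := by
  refine ⟨fun j => ⟨0, fun α => ?_⟩, 0, X i, fun γ _ => by simp⟩
  by_cases h : i = j
  · subst h
    exact ⟨Polynomial.X, fun t _ => by simp⟩
  · exact ⟨Polynomial.C (α i : K), fun t _ => by simp [h]⟩

theorem eval_aeval {σ τ : Type*} (x : σ → K) (g : τ → MvPolynomial σ K) (p : MvPolynomial τ K) :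
    eval x (aeval g p) = eval (fun i => eval x (g i)) p := by
  induction p using MvPolynomial.induction_on with
  | C a => simp
  | add p q hp hq => rw [map_add, map_add, map_add, hp, hq]
  | mul_X p i hp => rw [map_mul, map_mul, map_mul, hp, aeval_X, eval_X]

theorem shiftClosed_evPoly : ShiftClosed (evPoly K n) := by
  rintro f ⟨hf, N, p, hp⟩ δ
  refine ⟨fun j => ?_, N + ∑ i, (δ i).natAbs, aeval (fun i => X i + MvPolynomial.C (δ i : K)) p,
    fun γ h => ?_⟩
  · obtain ⟨N, hN⟩ := hf j
    refine ⟨N + (δ j).natAbs, fun α => ?_⟩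
    obtain ⟨q, hq⟩ := hN (α + δ)
    -- Off the axis `j` the truncation condition does not involve `t`: if it fails, the function is
    -- zero on the whole line, so the threshold stays independent of `α`.
    by_cases h : ∀ i, i ≠ j → 0 ≤ α i + δ i
    · refine ⟨q.comp (Polynomial.X + Polynomial.C (δ j : K)), fun t ht => ?_⟩
      have e : Function.update α j t + δ = Function.update (α + δ) j (t + δ j) := by
        funext i
        by_cases hi : i = j
        · subst hi; simp
        · simp [hi]
      beta_reduce
      rw [e, if_pos, hq _ (by omega)]
      · simp
      · intro i
        by_cases hi : i = j
        · subst hi; simp only [Function.update_self, Pi.zero_apply]; omega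
        · simpa [hi] using h i hi
    · refine ⟨0, fun t ht => ?_⟩
      beta_reduce
      rw [if_neg, Polynomial.eval_zero]
      intro h'
      refine h fun i hi => ?_
      have := h' i
      simpa [hi] using this
  · have hδ : ∀ i, (δ i).natAbs ≤ ∑ i, (δ i).natAbs := fun i =>
      Finset.single_le_sum (f := fun i => (δ i).natAbs) (fun _ _ => Nat.zero_le _) (Finset.mem_univ i)
    have h1 : ∀ i, (N : ℤ) ≤ γ i + δ i := fun i => by
      have := h i
      have := hδ i
      omega
    have h2 : 0 ≤ γ + δ := fun i => by
      have := h1 i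
      simp only [Pi.zero_apply, Pi.add_apply]
      omega
    beta_reduce
    rw [if_pos h2, hp (γ + δ) h1, eval_aeval]
    simp

theorem mulX_eq_shiftOp (i : Fin n) :
    mulX K n i = shiftOp (Pi.single i 1) ((fun γ : Fin n → ℤ => (γ i : K)) + 1) :=
  end_ext fun γ h => by rw [mulX_dp i h, shiftOp_dp _ _ h]; rfl

theorem del_eq_shiftOp (i : Fin n) : del K n i = shiftOp (-Pi.single i 1) 1 :=
  end_ext fun γ h => by rw [del_dp i h, shiftOp_dp _ _ h, Pi.one_apply, one_smul, sub_eq_add_neg]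

theorem integ_eq_shiftOp (i : Fin n) : integ K n i = shiftOp (Pi.single i 1) 1 :=
  end_ext fun γ h => by rw [integ_dp i h, shiftOp_dp _ _ h, Pi.one_apply, one_smul]

theorem opHInv_eq_shiftOp (i : Fin n) :
    opHInv K n i = shiftOp 0 (fun γ : Fin n → ℤ => ((γ i : K) + 1)⁻¹) :=
  end_ext fun γ h => by rw [opHInv_dp i h, shiftOp_dp _ _ h, add_zero]

theorem intDiffAlg_le_bandAlg : intDiffAlg K n ≤ bandAlg (evPoly K n) shiftClosed_evPoly := by
  refine Algebra.adjoin_le ?_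
  rintro _ ((⟨i, rfl⟩ | ⟨i, rfl⟩) | ⟨i, rfl⟩)
  · rw [mulX_eq_shiftOp]
    exact shiftOp_mem_bandAlg _ _ (add_mem (coord_mem_evPoly i) (one_mem _))
  · rw [del_eq_shiftOp]
    exact shiftOp_mem_bandAlg _ _ (one_mem _)
  · rw [integ_eq_shiftOp]
    exact shiftOp_mem_bandAlg _ _ (one_mem _)

theorem jacobianAlg_le_bandAlg : jacobianAlg K n ≤ bandAlg ⊤ shiftClosed_top := by
  refine Algebra.adjoin_le ?_
  rintro _ ((⟨i, rfl⟩ | ⟨i, rfl⟩) | ⟨i, rfl⟩)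
  · rw [mulX_eq_shiftOp]
    exact shiftOp_mem_bandAlg _ _ Algebra.mem_top
  · rw [del_eq_shiftOp]
    exact shiftOp_mem_bandAlg _ _ Algebra.mem_top
  · rw [opHInv_eq_shiftOp]
    exact shiftOp_mem_bandAlg _ _ Algebra.mem_top

/-! ### The ideals of operators vanishing far out in given directions -/

/-- The operator `a` vanishes on all monomials whose exponents in the directions in `J` are large. -/
def NegOn (J : Finset (Fin n)) (a : EndP K n) : Prop :=
  ∃ N : ℕ, ∀ γ, 0 ≤ γ → (∀ j ∈ J, (N : ℤ) ≤ γ j) → a (dp K n γ) = 0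

theorem NegOn.add {J : Finset (Fin n)} {a b : EndP K n} (ha : NegOn J a) (hb : NegOn J b) :
    NegOn J (a + b) := by
  obtain ⟨N, hN⟩ := ha
  obtain ⟨M, hM⟩ := hb
  refine ⟨max N M, fun γ h hγ => ?_⟩
  rw [LinearMap.add_apply, hN γ h fun j hj => by have := hγ j hj; omega,
    hM γ h fun j hj => by have := hγ j hj; omega, add_zero]

theorem NegOn.zero (J : Finset (Fin n)) : NegOn J (0 : EndP K n) := ⟨0, fun _ _ _ => rfl⟩

theorem NegOn.sum {ι : Type*} {J : Finset (Fin n)} {s : Finset ι} {a : ι → EndP K n}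
    (h : ∀ i ∈ s, NegOn J (a i)) : NegOn J (∑ i ∈ s, a i) :=
  Finset.sum_induction _ (NegOn J) (fun _ _ => NegOn.add) (NegOn.zero J) h

theorem NegOn.mul_left {J : Finset (Fin n)} {a : EndP K n} (b : EndP K n) (ha : NegOn J a) :
    NegOn J (b * a) := by
  obtain ⟨N, hN⟩ := ha
  exact ⟨N, fun γ h hγ => by rw [Module.End.mul_apply, hN γ h hγ, map_zero]⟩

/-- A factor from `A_n` lowers exponents by at most some `C`, so the threshold grows by `C`.
Multiplication on the left needs no such bound. -/
theorem NegOn.mul_right {J : Finset (Fin n)} {a b : EndP K n} (ha : NegOn J a)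
    (hb : b ∈ jacobianAlg K n) : NegOn J (a * b) := by
  obtain ⟨N, hN⟩ := ha
  obtain ⟨B, f, -, hf⟩ := exists_band_rep (jacobianAlg_le_bandAlg hb)
  obtain ⟨C, hC⟩ := exists_band_bound B
  refine ⟨N + C, fun γ h hγ => ?_⟩
  rw [Module.End.mul_apply, hf γ h, map_sum]
  refine Finset.sum_eq_zero fun β hβ => ?_
  rw [map_smul]
  by_cases h' : 0 ≤ γ + β
  · rw [hN _ h' fun j hj => ?_, smul_zero]
    have := hγ j hj
    have := hC β hβ j
    simp only [Pi.add_apply]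
    push_cast at *
    omega
  · rw [dp_of_not_nonneg h', map_zero, smul_zero]

theorem negOn_empty {a : EndP K n} (h : NegOn ∅ a) : a = 0 := by
  obtain ⟨N, hN⟩ := h
  exact end_ext fun γ h => by rw [hN γ h (by simp)]; rfl

/-- Only inputs with `γ k < N` survive, and the bounded shifts raise their `k`-th exponent to less
than `N + C`. -/
theorem NegOn.exists_tail_mul_eq_zero {k : Fin n} {a : EndP K n} (ha : NegOn {k} a)
    (hb : a ∈ jacobianAlg K n) : ∃ N, ∀ M ≥ N, tail K n k M * a = 0 := by
  obtain ⟨N, hN⟩ := ha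
  obtain ⟨B, f, -, hf⟩ := exists_band_rep (jacobianAlg_le_bandAlg hb)
  obtain ⟨C, hC⟩ := exists_band_bound B
  refine ⟨N + C, fun M hM => end_ext fun γ h => ?_⟩
  rw [Module.End.mul_apply, LinearMap.zero_apply]
  by_cases hk : (N : ℤ) ≤ γ k
  · rw [hN γ h (by simpa using hk), map_zero]
  · rw [hf γ h, map_sum]
    refine Finset.sum_eq_zero fun β hβ => ?_
    rw [map_smul]
    by_cases h' : 0 ≤ γ + β
    · rw [tail_dp k M h', if_neg, smul_zero]
      have := hC β hβ k
      simp only [Pi.add_apply]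
      omega
    · rw [dp_of_not_nonneg h', map_zero, smul_zero]

/-- Inputs with `γ k ≥ N + C` have outputs fixed by the projection `tail K n k N`, so these outputs
vanish. -/
theorem negOn_of_tail_mul_eq_zero {k : Fin n} {a : EndP K n} {N : ℕ} (ha : tail K n k N * a = 0)
    (hb : a ∈ jacobianAlg K n) : NegOn {k} a := by
  obtain ⟨B, f, -, hf⟩ := exists_band_rep (jacobianAlg_le_bandAlg hb)
  obtain ⟨C, hC⟩ := exists_band_bound B
  refine ⟨N + C, fun γ h hγ => ?_⟩
  have h1 : tail K n k N (a (dp K n γ)) = a (dp K n γ) := by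
    rw [hf γ h, map_sum]
    refine Finset.sum_congr rfl fun β hβ => ?_
    rw [map_smul]
    by_cases h' : 0 ≤ γ + β
    · rw [tail_dp k N h', if_pos]
      have := hC β hβ k
      have := hγ k (by simp)
      simp only [Pi.add_apply]
      push_cast at *
      omega
    · rw [dp_of_not_nonneg h', map_zero]
  rw [← h1, ← Module.End.mul_apply, ha, LinearMap.zero_apply]

theorem NegOn.exists_mul_tail_eq_zero {k : Fin n} {a : EndP K n} (ha : NegOn {k} a) :
    ∃ N, ∀ M ≥ N, a * tail K n k M = 0 := by
  obtain ⟨N, hN⟩ := ha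
  refine ⟨N, fun M hM => end_ext fun γ h => ?_⟩
  rw [Module.End.mul_apply, tail_dp k M h, LinearMap.zero_apply]
  split_ifs with hk
  · exact hN γ h (by simp; omega)
  · exact map_zero a

/-! ### Primeness of the ideal attached to a direction -/

theorem exists_int_eval_ne_zero {q : Polynomial K} (hq : q ≠ 0) (N : ℤ) :
    ∃ t : ℤ, N ≤ t ∧ q.eval (t : K) ≠ 0 := by
  by_contra! h
  refine hq (Polynomial.eq_zero_of_infinite_isRoot q ?_)
  refine ((Set.Ici_infinite N).image (f := fun t : ℤ => (t : K))
    (Int.cast_injective.injOn)).mono ?_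
  rintro _ ⟨t, ht, rfl⟩
  exact h t ht

/-- A product of one matrix unit per direction in `s`. Omitting one direction gives an operator
moving lines to lines; taking all directions gives a rank-one operator. -/
theorem exists_matUnit_prod (s : Finset (Fin n)) (src tgt : Fin n → ℕ) :
    ∃ r ∈ intDiffAlg K n, ∀ γ, 0 ≤ γ → r (dp K n γ) =
      if ∀ i ∈ s, γ i = src i then dp K n (fun i => if i ∈ s then (tgt i : ℤ) else γ i) else 0 := by
  induction s using Finset.induction_on with
  | empty => exact ⟨1, one_mem _, fun γ _ => by simp⟩
  | insert j s hj ih =>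
    obtain ⟨r, hr, h⟩ := ih
    refine ⟨matUnit K n j (tgt j) (src j) * r, mul_mem (matUnit_mem _ _ _) hr, fun γ hγ => ?_⟩
    rw [Module.End.mul_apply, h γ hγ]
    by_cases h1 : ∀ i ∈ s, γ i = src i
    · have h0 : 0 ≤ fun i => if i ∈ s then (tgt i : ℤ) else γ i := by
        intro i
        by_cases hi : i ∈ s
        · simp [hi]
        · simpa [hi] using hγ i
      rw [if_pos h1, matUnit_dp _ _ _ h0, if_neg hj]
      by_cases h2 : γ j = src j
      · rw [if_pos h2, if_pos]
        · congr 1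
          funext i
          by_cases hi : i = j
          · subst hi; simp
          · simp [hi]
        · intro i hi
          rcases Finset.mem_insert.1 hi with rfl | hi
          exacts [h2, h1 i hi]
      · rw [if_neg h2, if_neg fun h => h2 (h j (Finset.mem_insert_self _ _))]
    · rw [if_neg h1, map_zero, if_neg fun h => h1 fun i hi => h i (Finset.mem_insert_of_mem hi)]

/-- Far out in direction `k` some column has a nonzero entry. Among the shifts agreeing with that
entry's shift off `k` and having a nonzero coefficient polynomial on the line through `α`, the one
with the largest `k`-entry is taken; higher shifts then have coefficient zero far along this line.
-/
theorem exists_leading_coeff {k : Fin n} {a : EndP K n} {A : Finset (Fin n → ℤ)}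
    {f : (Fin n → ℤ) → (Fin n → ℤ) → K} (hf : ∀ β, f β ∈ evPoly K n)
    (ha : ∀ γ, 0 ≤ γ → a (dp K n γ) = ∑ β ∈ A, f β γ • dp K n (γ + β)) (h : ¬ NegOn {k} a) :
    ∃ α : Fin n → ℤ, 0 ≤ α ∧ ∃ β ∈ A, ∃ q : Polynomial K, q ≠ 0 ∧ ∃ N : ℕ,
      (∀ i, i ≠ k → 0 ≤ α i + β i) ∧
      (∀ t : ℤ, N ≤ t → f β (Function.update α k t) = q.eval (t : K)) ∧
      ∀ β' ∈ A, (∀ i, i ≠ k → β' i = β i) → β k < β' k →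
        ∀ t : ℤ, N ≤ t → f β' (Function.update α k t) = 0 := by
  -- Thresholds independent of the line are essential here: they are fixed before `α` is chosen.
  choose M hM using fun β => (hf β).1 k
  have hsup : ∀ β ∈ A, M β ≤ A.sup M := fun β hβ => Finset.le_sup hβ
  have h' : ∃ γ, 0 ≤ γ ∧ ((A.sup M : ℕ) : ℤ) ≤ γ k ∧ a (dp K n γ) ≠ 0 := by
    by_contra! hc
    exact h ⟨A.sup M, fun γ h0 hγ => hc γ h0 (hγ k (by simp))⟩
  obtain ⟨α, hα, hk, hne⟩ := h'
  rw [ha α hα] at hne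
  obtain ⟨β₀, hβ₀, hne₀⟩ := Finset.exists_ne_zero_of_sum_ne_zero hne
  have hf0 : f β₀ α ≠ 0 := fun h => hne₀ (by rw [h, zero_smul])
  have h0 : 0 ≤ α + β₀ := by
    by_contra hc
    exact hne₀ (by rw [dp_of_not_nonneg hc, smul_zero])
  choose q hq using fun β => hM β α
  have hq0 : q β₀ ≠ 0 := by
    intro hz
    have := hq β₀ (α k) (by have := hsup β₀ hβ₀; omega)
    rw [Function.update_eq_self, hz, Polynomial.eval_zero] at this
    exact hf0 this
  obtain ⟨β, hβ, hmax⟩ := Finset.exists_max_image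
    (A.filter fun β => (∀ i, i ≠ k → β i = β₀ i) ∧ q β ≠ 0) (fun β => β k)
    ⟨β₀, by simp [hβ₀, hq0]⟩
  simp only [Finset.mem_filter] at hβ hmax
  refine ⟨α, hα, β, hβ.1, q β, hβ.2.2, A.sup M, fun i hi => ?_, fun t ht => ?_,
    fun β' hβ' he hlt t ht => ?_⟩
  · rw [hβ.2.1 i hi]
    exact h0 i
  · exact hq β t (by have := hsup β hβ.1; omega)
  · rw [hq β' t (by have := hsup β' hβ'; omega)]
    by_contra hc
    have := hmax β' ⟨hβ', fun i hi => (he i hi).trans (hβ.2.1 i hi), fun hz => hc (by rw [hz, Polynomial.eval_zero])⟩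
    omega

/-- The matrix unit `r` moves the line reached by the leading shift `τ` of `b` to the line where `a`
has leading shift `ρ`. At the index `T` only the pair `(τ, ρ)` contributes, and its coefficient is a
product of two nonzero polynomials in `t`. -/
theorem exists_mul_mul_not_negOn {k : Fin n} {a b : EndP K n} (ha : a ∈ intDiffAlg K n)
    (hb : b ∈ intDiffAlg K n) (ha' : ¬ NegOn {k} a) (hb' : ¬ NegOn {k} b) :
    ∃ r ∈ intDiffAlg K n, ¬ NegOn {k} (a * r * b) := by
  obtain ⟨A, f, hf, hA⟩ := exists_band_rep (intDiffAlg_le_bandAlg ha)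
  obtain ⟨B, g, hg, hB⟩ := exists_band_rep (intDiffAlg_le_bandAlg hb)
  obtain ⟨α, hα, ρ, hρ, p, hp, N, hαρ, hfp, hf0⟩ := exists_leading_coeff hf hA ha'
  obtain ⟨β, hβ, τ, hτ, q, hq, M, hβτ, hgq, hg0⟩ := exists_leading_coeff hg hB hb'
  obtain ⟨C, hC⟩ := exists_band_bound B
  obtain ⟨r, hr, hrdp⟩ := exists_matUnit_prod (K := K) (Finset.univ.erase k)
    (fun i => (β i + τ i).toNat) (fun i => (α i).toNat)
  refine ⟨r, hr, ?_⟩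
  rintro ⟨L, hL⟩
  have hpq : p.comp (Polynomial.X + Polynomial.C (τ k : K)) * q ≠ 0 :=
    mul_ne_zero (fun h => by
      have h2 := congrArg (fun p => Polynomial.comp p (Polynomial.X - Polynomial.C (τ k : K))) h
      simp only [Polynomial.comp_assoc, Polynomial.zero_comp] at h2
      simp at h2
      exact hp h2) hq
  obtain ⟨t, ht, hne⟩ := exists_int_eval_ne_zero hpq (L + N + M + 2 * C + (ρ k).natAbs)
  have hu : 0 ≤ Function.update β k t := by
    intro i
    by_cases hi : i = k
    · subst hi; simp only [Pi.zero_apply, Function.update_self]; omega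
    · simpa [hi] using hβ i
  have h1 := hL _ hu (by simp; omega)
  set T : Fin n → ℤ := Function.update (α + ρ) k (t + τ k + ρ k) with hT
  have hT0 : 0 ≤ T := by
    intro i
    by_cases hi : i = k
    · subst hi
      have := hC τ hτ i
      simp only [hT, Pi.zero_apply, Function.update_self]; omega
    · simpa [hT, hi] using hαρ i hi
  have h2 := congrArg (cf K n T) h1
  rw [map_zero, mul_assoc, Module.End.mul_apply, Module.End.mul_apply, hB _ hu, map_sum, map_sum,
    map_sum, Finset.sum_eq_single_of_mem τ hτ] at h2
  · have h3 : r (dp K n (Function.update β k t + τ)) = dp K n (Function.update α k (t + τ k)) := by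
      rw [hrdp, if_pos]
      · congr 1
        funext i
        by_cases hi : i = k
        · subst hi; simp
        · have := hα i
          simp only [Pi.zero_apply] at this
          simp [hi, this]
      · intro i hi
        have hi := Finset.ne_of_mem_erase hi
        have := hβτ i hi
        simp [hi, this]
      · intro i
        by_cases hi : i = k
        · subst hi
          have := hC τ hτ i
          simp only [Pi.zero_apply, Pi.add_apply, Function.update_self]; omega
        · simpa [hi] using hβτ i hi
    have hu2 : 0 ≤ Function.update α k (t + τ k) := by
      intro i
      by_cases hi : i = k
      · subst hi
        have := hC τ hτ i
        simp only [Pi.zero_apply, Function.update_self]; omega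
      · simpa [hi] using hα i
    have hTe : T = Function.update α k (t + τ k) + ρ := by
      funext i
      by_cases hi : i = k
      · subst hi; simp [hT]
      · simp [hT, hi]
    rw [map_smul, map_smul, map_smul, h3, hA _ hu2, map_sum, Finset.sum_eq_single_of_mem ρ hρ] at h2
    · have := hC τ hτ k
      rw [map_smul, ← hTe, cf_dp_self hT0, hgq t (by omega), hfp _ (by omega)] at h2
      refine hne ?_
      rw [Polynomial.eval_mul, Polynomial.eval_comp]
      simp only [smul_eq_mul, mul_one] at h2
      rw [mul_comm]
      simpa using h2
    · intro σ _ hσ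
      rw [map_smul]
      by_cases h0 : 0 ≤ Function.update α k (t + τ k) + σ
      · rw [cf_dp h0, if_neg, smul_zero]
        rw [hTe]
        exact fun h => hσ (add_left_cancel h).symm
      · rw [dp_of_not_nonneg h0, map_zero, smul_zero]
  · intro σ hσ hne
    rw [map_smul, map_smul, map_smul]
    by_cases h0 : 0 ≤ Function.update β k t + σ
    swap
    · rw [dp_of_not_nonneg h0, map_zero, map_zero, map_zero, smul_zero]
    rw [hrdp _ h0]
    split_ifs with hm
    swap
    · rw [map_zero, map_zero, smul_zero]
    have hm' : ∀ i, i ≠ k → σ i = τ i := fun i hi => by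
      have h4 := hm i (Finset.mem_erase.2 ⟨hi, Finset.mem_univ i⟩)
      have h5 := hβτ i hi
      simp only [Pi.add_apply, Function.update_of_ne hi] at h4
      omega
    have hlt : σ k ≠ τ k := fun h => hne (funext fun i => by
      by_cases hi : i = k
      · subst hi; exact h
      · exact hm' i hi)
    -- A shift below `τ` can reach `T` only through a shift of `a` above `ρ`, whose coefficient
    -- vanishes; a shift above `τ` has coefficient zero itself.
    rcases lt_or_gt_of_ne hlt with hlt | hgt
    · have hCσ := hC σ hσ k
      have hCτ := hC τ hτ k
      have e : (fun i => if i ∈ Finset.univ.erase k then ((α i).toNat : ℤ)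
          else (Function.update β k t + σ) i) = Function.update α k (t + σ k) := by
        funext i
        by_cases hi : i = k
        · subst hi; simp
        · have := hα i
          simp only [Pi.zero_apply] at this
          simp [hi, this]
      have hu2 : 0 ≤ Function.update α k (t + σ k) := by
        intro i
        by_cases hi : i = k
        · subst hi
          simp only [Pi.zero_apply, Function.update_self]; omega
        · simpa [hi] using hα i
      rw [e, hA _ hu2, map_sum, Finset.sum_eq_zero, smul_zero]
      intro ρ' hρ'
      rw [map_smul]
      by_cases h6 : 0 ≤ Function.update α k (t + σ k) + ρ'
      swap
      · rw [dp_of_not_nonneg h6, map_zero, smul_zero]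
      rw [cf_dp h6]
      split_ifs with h7
      swap
      · rw [smul_zero]
      rw [hf0 ρ' hρ' _ _ _ (by omega), zero_smul]
      · intro i hi
        have := congrFun h7 i
        simp [hT, hi] at this
        exact this.symm
      · have := congrFun h7 k
        simp [hT] at this
        omega
    · rw [hg0 σ hσ hm' hgt t (by omega), zero_smul]

/-! ### The action of an automorphism on the prime ideals -/

/-- Algebra automorphisms of `End(P_n)` that preserve rank finiteness and the subalgebra `I_n`. -/
structure Normalizes (Φ : EndP K n ≃ₐ[K] EndP K n) : Prop where
  mem_iff : ∀ a, Φ a ∈ intDiffAlg K n ↔ a ∈ intDiffAlg K n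
  finite_iff : ∀ a, FiniteDimensional K (LinearMap.range (Φ a)) ↔
    FiniteDimensional K (LinearMap.range a)

theorem Normalizes.symm {Φ : EndP K n ≃ₐ[K] EndP K n} (h : Normalizes Φ) : Normalizes Φ.symm where
  mem_iff a := by rw [← h.mem_iff, Φ.apply_symm_apply]
  finite_iff a := by rw [← h.finite_iff, Φ.apply_symm_apply]

theorem mem_jacobianAlg {a : EndP K n} (h : a ∈ intDiffAlg K n) : a ∈ jacobianAlg K n :=
  intDiffAlg_le_jacobianAlg K n h

theorem span_range_dp : Submodule.span K (dp K n '' {γ | 0 ≤ γ}) = ⊤ := by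
  rw [eq_top_iff, ← (dpBasis K n).span_eq]
  refine Submodule.span_mono ?_
  rintro _ ⟨α, rfl⟩
  exact ⟨_, fun i => Int.natCast_nonneg (α i), dp_natCast α⟩

/-- A basis vector with any exponent beyond the common threshold is killed, so the images of a
finite box span the range. -/
theorem finite_range_of_negOn {c : EndP K n} (h : ∀ j, NegOn {j} c) :
    FiniteDimensional K (LinearMap.range c) := by
  choose N hN using h
  have hsup : ∀ j, N j ≤ Finset.univ.sup N := fun j => Finset.le_sup (Finset.mem_univ j)
  have hle : LinearMap.range c ≤ Submodule.span K
      ((fun γ => c (dp K n γ)) '' (Set.Icc 0 fun _ => ((Finset.univ.sup N : ℕ) : ℤ))) := by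
    rw [LinearMap.range_eq_map, ← span_range_dp, Submodule.map_span_le]
    rintro _ ⟨γ, hγ, rfl⟩
    by_cases h : γ ≤ fun _ => ((Finset.univ.sup N : ℕ) : ℤ)
    · exact Submodule.subset_span ⟨γ, ⟨hγ, h⟩, rfl⟩
    · obtain ⟨j, hj⟩ := not_forall.1 h
      rw [hN j γ hγ]
      · exact zero_mem _
      · have := hsup j
        simp only [Finset.mem_singleton, forall_eq]
        simp only at hj
        omega
  have : FiniteDimensional K (Submodule.span K
      ((fun γ => c (dp K n γ)) '' (Set.Icc 0 fun _ => ((Finset.univ.sup N : ℕ) : ℤ)))) :=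
    FiniteDimensional.span_of_finite K ((Set.finite_Icc _ _).image _)
  exact Submodule.finiteDimensional_of_le hle

theorem exists_tail_eq_zero (k : Fin n) (p : MvPolynomial (Fin n) K) :
    ∃ N, ∀ M ≥ N, tail K n k M p = 0 := by
  have hp : p ∈ Submodule.span K (dp K n '' {γ | 0 ≤ γ}) := by rw [span_range_dp]; trivial
  induction hp using Submodule.span_induction with
  | mem x hx =>
    obtain ⟨γ, hγ, rfl⟩ := hx
    refine ⟨(γ k).toNat + 1, fun M hM => ?_⟩
    rw [tail_dp k M hγ, if_neg]
    omega
  | zero => exact ⟨0, fun M _ => map_zero _⟩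
  | add x y _ _ hx hy =>
    obtain ⟨N, hN⟩ := hx
    obtain ⟨L, hL⟩ := hy
    exact ⟨max N L, fun M hM => by rw [map_add, hN M (by omega), hL M (by omega), add_zero]⟩
  | smul r x _ hx =>
    obtain ⟨N, hN⟩ := hx
    exact ⟨N, fun M hM => by rw [map_smul, hN M hM, smul_zero]⟩

/-- Finitely many generators of the range involve bounded exponents, so a far enough tail projection
annihilates them. -/
theorem negOn_of_finite_range {c : EndP K n} (hc : c ∈ intDiffAlg K n)
    (h : FiniteDimensional K (LinearMap.range c)) (k : Fin n) : NegOn {k} c := by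
  obtain ⟨S, hS⟩ := (Submodule.fg_iff_finiteDimensional _).2 h
  choose N hN using exists_tail_eq_zero (K := K) k
  refine negOn_of_tail_mul_eq_zero (N := S.sup N) (LinearMap.ext fun p => ?_) (mem_jacobianAlg hc)
  have hle : Submodule.span K (S : Set (MvPolynomial (Fin n) K)) ≤
      LinearMap.ker (tail K n k (S.sup N)) := by
    rw [Submodule.span_le]
    intro w hw
    exact hN w _ (Finset.le_sup hw)
  rw [hS] at hle
  exact hle ⟨p, rfl⟩

theorem not_negOn_one (k : Fin n) : ¬ NegOn {k} (1 : EndP K n) := by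
  rintro ⟨N, hN⟩
  have h0 : 0 ≤ fun _ : Fin n => (N : ℤ) := fun _ => Int.natCast_nonneg N
  have := congrArg (cf K n fun _ => (N : ℤ)) (hN _ h0 (by simp))
  rw [Module.End.one_apply, cf_dp_self h0, map_zero] at this
  exact one_ne_zero this

/-- `Φ` maps the height one prime ideal of the direction `j` into that of the direction `k`. -/
def MapsPrime (Φ : EndP K n ≃ₐ[K] EndP K n) (j k : Fin n) : Prop :=
  ∀ a ∈ intDiffAlg K n, NegOn {j} a → NegOn {k} (Φ a)

/-- Otherwise primeness combines witnesses, one for each `j`, into an element `c` of every `p_j`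
with `Φ c` outside `p_k`. But `c` has finite rank, hence so has `Φ c`, which then lies in `p_k`. -/
theorem Normalizes.exists_mapsPrime {Φ : EndP K n ≃ₐ[K] EndP K n} (h : Normalizes Φ) (k : Fin n) :
    ∃ j, MapsPrime Φ j k := by
  by_contra! hc
  simp only [MapsPrime, not_forall] at hc
  choose a ha hna hΦ using hc
  have key : ∀ J : Finset (Fin n), ∃ c ∈ intDiffAlg K n, (∀ j ∈ J, NegOn {j} c) ∧ ¬ NegOn {k} (Φ c) := by
    intro J
    induction J using Finset.induction_on with
    | empty => exact ⟨1, one_mem _, by simp, by rw [map_one]; exact not_negOn_one k⟩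
    | insert j J _ ih =>
      obtain ⟨c, hc, hJ, hk⟩ := ih
      obtain ⟨r, hr, hr'⟩ := exists_mul_mul_not_negOn ((h.mem_iff c).2 hc) ((h.mem_iff _).2 (ha j))
        hk (hΦ j)
      have hs := (h.symm.mem_iff r).2 hr
      refine ⟨c * Φ.symm r * a j, mul_mem (mul_mem hc hs) (ha j), fun i hi => ?_, ?_⟩
      · rcases Finset.mem_insert.1 hi with rfl | hi
        · exact (hna i).mul_left _
        · rw [mul_assoc]
          exact (hJ i hi).mul_right (mem_jacobianAlg (mul_mem hs (ha j)))
      · rwa [map_mul, map_mul, Φ.apply_symm_apply]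
  obtain ⟨c, hc, hJ, hk⟩ := key Finset.univ
  have hfin := finite_range_of_negOn fun j => hJ j (Finset.mem_univ j)
  exact hk (negOn_of_finite_range ((h.mem_iff c).2 hc) ((h.finite_iff c).2 hfin) k)

theorem negOn_matUnit_zero (j : Fin n) : NegOn {j} (matUnit K n j 0 0) :=
  ⟨1, fun γ h hγ => by
    rw [matUnit_dp _ _ _ h, if_neg]
    have := hγ j (by simp)
    push_cast at *
    omega⟩

/-- For `k ≠ j` the operator `e_{00}(j)` does not see the `k`-th exponent. Hence the ideals `p_k`
are pairwise incomparable. -/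
theorem eq_of_negOn_matUnit_zero {j k : Fin n} (h : NegOn {k} (matUnit K n j 0 0)) : j = k := by
  by_contra hne
  obtain ⟨N, hN⟩ := h
  have h0 : (0 : Fin n → ℤ) ≤ Pi.single k (N : ℤ) := Pi.single_nonneg.2 (Int.natCast_nonneg N)
  have h1 := hN _ h0 (by simp)
  rw [matUnit_dp _ _ _ h0, if_pos (by simp [hne])] at h1
  have h2 : (0 : Fin n → ℤ) ≤ Function.update (Pi.single k (N : ℤ)) j ((0 : ℕ) : ℤ) := by
    intro i
    by_cases hi : i = j
    · subst hi; simp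
    · simpa [hi] using h0 i
  have h3 := congrArg (cf K n (Function.update (Pi.single k (N : ℤ)) j ((0 : ℕ) : ℤ))) h1
  rw [cf_dp_self h2, map_zero] at h3
  exact one_ne_zero h3

/-- By incomparability the choice `f` of a source prime for each target is injective, hence
surjective on the finite index set. -/
theorem Normalizes.exists_mapsPrime_symm {Φ : EndP K n ≃ₐ[K] EndP K n} (h : Normalizes Φ)
    (j : Fin n) : ∃ i, MapsPrime Φ.symm j i := by
  choose f hf using h.symm.exists_mapsPrime
  have hinj : Function.Injective f := by
    have aux : ∀ k l, MapsPrime Φ l (f k) → l = k := by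
      intro k l hl
      refine eq_of_negOn_matUnit_zero (K := K) ?_
      have := hf k _ ((h.mem_iff _).2 (matUnit_mem l 0 0)) (hl _ (matUnit_mem l 0 0) (negOn_matUnit_zero l))
      rwa [Φ.symm_apply_apply] at this
    intro k k' hk
    obtain ⟨l, hl⟩ := h.exists_mapsPrime (f k)
    rw [← aux k l hl, aux k' l (hk ▸ hl)]
  obtain ⟨i, rfl⟩ := (Finite.injective_iff_surjective.1 hinj) j
  exact ⟨i, hf i⟩

/-! ### Correcting a right inverse of `Φ(H_i)` one direction at a time -/

theorem opH_mul_matUnit_comm {i j : Fin n} (h : i ≠ j) (s t : ℕ) :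
    opH K n i * matUnit K n j s t = matUnit K n j s t * opH K n i := by
  refine end_ext fun γ hγ => ?_
  rw [Module.End.mul_apply, Module.End.mul_apply, opH_dp i hγ, matUnit_dp _ _ _ hγ, map_smul,
    matUnit_dp _ _ _ hγ]
  split_ifs
  · rw [opH_dp, Function.update_of_ne h]
    intro k
    by_cases hk : k = j
    · subst hk; simp
    · simpa [hk] using hγ k
  · rw [map_zero, smul_zero]

theorem update_nonneg {γ : Fin n → ℤ} (hγ : 0 ≤ γ) (i : Fin n) (k : ℕ) :
    0 ≤ Function.update γ i (k : ℤ) := by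
  intro l
  by_cases hl : l = i
  · subst hl; simp
  · simpa [hl] using hγ l

theorem matUnit_mul (i : Fin n) (s t u : ℕ) :
    matUnit K n i s t * matUnit K n i t u = matUnit K n i s u := by
  refine end_ext fun γ hγ => ?_
  rw [Module.End.mul_apply, matUnit_dp _ _ _ hγ, matUnit_dp _ _ _ hγ]
  split_ifs
  · rw [matUnit_dp _ _ _ (update_nonneg hγ i t), Function.update_self, if_pos rfl,
      Function.update_idem]
  · exact map_zero _

theorem sum_smul_matUnit_dp (i : Fin n) (L : ℕ) (c : ℕ → K) {γ : Fin n → ℤ} (hγ : 0 ≤ γ) :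
    (∑ k ∈ Finset.range L, c k • matUnit K n i k k) (dp K n γ)
      = if γ i < L then c (γ i).toNat • dp K n γ else 0 := by
  have h0 := hγ i
  simp only [Pi.zero_apply] at h0
  rw [LinearMap.sum_apply]
  simp only [LinearMap.smul_apply, matUnit_dp i _ _ hγ]
  have : ∀ k : ℕ, γ i = k ↔ k = (γ i).toNat := fun k => by omega
  split_ifs with h
  · rw [Finset.sum_eq_single_of_mem (γ i).toNat (by simp; omega)]
    · rw [if_pos (by omega)]
      congr 2
      rw [Int.toNat_of_nonneg h0, Function.update_eq_self]
    · intro k _ hk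
      rw [if_neg (by rw [this]; exact hk), smul_zero]
  · refine Finset.sum_eq_zero fun k hk => ?_
    have := Finset.mem_range.1 hk
    rw [if_neg (by omega), smul_zero]

theorem sum_matUnit (i : Fin n) (L : ℕ) :
    ∑ k ∈ Finset.range L, matUnit K n i k k = 1 - tail K n i L := by
  refine end_ext fun γ hγ => ?_
  have := sum_smul_matUnit_dp (K := K) i L (fun _ => 1) hγ
  simp only [one_smul] at this
  rw [this, LinearMap.sub_apply, tail_dp i L hγ, Module.End.one_apply]
  split_ifs <;> first | omega | simp

theorem tail_mul_matUnit (i : Fin n) (L t : ℕ) :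
    tail K n i L * matUnit K n i L t = matUnit K n i L t := by
  refine end_ext fun γ hγ => ?_
  rw [Module.End.mul_apply, matUnit_dp _ _ _ hγ]
  split_ifs
  · rw [tail_dp _ _ (update_nonneg hγ i L), Function.update_self, if_pos le_rfl]
  · exact map_zero _

theorem opH_mul_sum_matUnit (i : Fin n) (L : ℕ) :
    opH K n i * ∑ k ∈ Finset.range L, ((k : K) + 1)⁻¹ • matUnit K n i k k = 1 - tail K n i L := by
  refine end_ext fun γ hγ => ?_
  rw [Module.End.mul_apply, sum_smul_matUnit_dp i L _ hγ, LinearMap.sub_apply, tail_dp i L hγ,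
    Module.End.one_apply]
  have h0 := hγ i
  simp only [Pi.zero_apply] at h0
  split_ifs with h1 h2 h2
  · omega
  · have e : (((γ i).toNat : ℕ) : K) = (γ i : K) := by
      rw [← Int.cast_natCast, Int.toNat_of_nonneg h0]
    rw [map_smul, opH_dp i hγ, smul_smul, e, inv_mul_cancel₀ (succ_ne_zero_of_nonneg hγ i),
      one_smul, sub_zero]
  · rw [map_zero, sub_self]
  · omega

theorem negOn_one_sub_tail (j : Fin n) (N : ℕ) : NegOn {j} (1 - tail K n j N) :=
  ⟨N, fun γ h hγ => by
    rw [LinearMap.sub_apply, tail_dp j N h, if_pos (hγ j (by simp)), Module.End.one_apply, sub_self]⟩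

/-- The given `G` already works modulo `NegOn J` on the range of `tail K n j N`, so only the
complementary strip `γ j < N` needs a new inverse. Its projection lies in `p_j`, and its preimage
`u` in `p_i` involves only exponents below `L` in direction `i`. -/
theorem exists_right_inverse_step {Φ : EndP K n ≃ₐ[K] EndP K n} (h : Normalizes Φ) (i₀ j : Fin n)
    (J : Finset (Fin n))
    (hG : ∃ G ∈ jacobianAlg K n, NegOn (insert j J) (Φ (opH K n i₀) * G - 1)) :
    ∃ G ∈ jacobianAlg K n, NegOn J (Φ (opH K n i₀) * G - 1) := by
  obtain ⟨G, hG, N, hN⟩ := hG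
  obtain ⟨i, hi⟩ := h.exists_mapsPrime_symm j
  set X := Φ (opH K n i₀) with hX
  set u := Φ.symm (1 - tail K n j N) with hu
  have hΦu : Φ u = 1 - tail K n j N := Φ.apply_symm_apply _
  have hImem : 1 - tail K n j N ∈ intDiffAlg K n := sub_mem (one_mem _) (tail_mem j N)
  have humem : u ∈ intDiffAlg K n := (h.symm.mem_iff _).2 hImem
  have huneg : NegOn {i} u := hi _ hImem (negOn_one_sub_tail j N)
  have hτ : NegOn J ((X * G - 1) * tail K n j N) := by
    refine ⟨N, fun γ hγ hJ => ?_⟩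
    rw [Module.End.mul_apply, tail_dp j N hγ]
    split_ifs with hj
    · refine hN γ hγ fun l hl => ?_
      rcases Finset.mem_insert.1 hl with rfl | hl
      exacts [hj, hJ l hl]
    · exact map_zero _
  suffices hs : ∃ G' ∈ jacobianAlg K n, NegOn J ((X * G' - 1) * (1 - tail K n j N)) by
    obtain ⟨G', hG', h'⟩ := hs
    refine ⟨G * tail K n j N + G' * (1 - tail K n j N),
      add_mem (mul_mem hG (mem_jacobianAlg (tail_mem j N))) (mul_mem hG' (mem_jacobianAlg hImem)), ?_⟩
    convert hτ.add h' using 1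
    simp only [mul_sub, sub_mul, mul_add, mul_one, one_mul, mul_assoc]
    abel
  obtain ⟨L₁, hL₁⟩ := huneg.exists_tail_mul_eq_zero (mem_jacobianAlg humem)
  obtain ⟨L₂, hL₂⟩ := huneg.exists_mul_tail_eq_zero
  set L := max L₁ L₂
  have hlu : tail K n i L * u = 0 := hL₁ L (le_max_left _ _)
  have hru : u * tail K n i L = 0 := hL₂ L (le_max_right _ _)
  have hu1 : (1 - tail K n i L) * u = u := by rw [sub_mul, one_mul, hlu, sub_zero]
  have hΦmem : ∀ s t, Φ (matUnit K n i s t) ∈ jacobianAlg K n := fun s t =>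
    mem_jacobianAlg ((h.mem_iff _).2 (matUnit_mem i s t))
  by_cases hii : i = i₀
  · subst hii
    -- On exponents below `L` the operator `H_i` is inverted by a finite combination of matrix
    -- units, already in `I_n`.
    refine ⟨Φ (∑ k ∈ Finset.range L, ((k : K) + 1)⁻¹ • matUnit K n i k k),
      mem_jacobianAlg ((h.mem_iff _).2 (sum_mem fun k _ => Subalgebra.smul_mem _ (matUnit_mem i k k) _)), ?_⟩
    rw [hX, ← map_mul, opH_mul_sum_matUnit, ← hΦu, sub_mul, one_mul, ← map_mul, hu1, sub_self]
    exact NegOn.zero J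
  -- For `i ≠ i₀` the matrix units in direction `i` commute with `H_{i₀}`: they carry the strip to
  -- level `L`, where `G` works modulo `NegOn J`, and back.
  · refine ⟨∑ k ∈ Finset.range L, Φ (matUnit K n i k L) * G * Φ (matUnit K n i L k),
      sum_mem fun k _ => mul_mem (mul_mem (hΦmem _ _) hG) (hΦmem _ _), ?_⟩
    have hcomm : ∀ k, X * Φ (matUnit K n i k L) = Φ (matUnit K n i k L) * X := fun k => by
      rw [hX, ← map_mul, ← map_mul, opH_mul_matUnit_comm (Ne.symm hii)]
    have hone : 1 - tail K n j N = ∑ k ∈ Finset.range L,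
        Φ (matUnit K n i k L) * Φ (matUnit K n i L k) * (1 - tail K n j N) := by
      simp only [← map_mul, matUnit_mul]
      rw [← Finset.sum_mul, ← map_sum, sum_matUnit, ← hΦu, ← map_mul, hu1]
    have e : (X * ∑ k ∈ Finset.range L, Φ (matUnit K n i k L) * G * Φ (matUnit K n i L k) - 1) *
        (1 - tail K n j N) = ∑ k ∈ Finset.range L, Φ (matUnit K n i k L) *
          ((X * G - 1) * tail K n j N * (Φ (matUnit K n i L k) * (1 - tail K n j N))) := by
      -- Level `L` lies beyond the support of `u`, so `Φ (matUnit K n i L k)` takes its values in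
      -- the range of `tail K n j N`.
      have hvan : ∀ k, (1 - tail K n j N) * Φ (matUnit K n i L k) = 0 := fun k => by
        rw [← tail_mul_matUnit, ← hΦu, ← map_mul, ← mul_assoc, hru, zero_mul, map_zero]
      have htl : ∀ k, tail K n j N * Φ (matUnit K n i L k) = Φ (matUnit K n i L k) := fun k => by
        have := hvan k
        rw [sub_mul, one_mul, sub_eq_zero] at this
        exact this.symm
      rw [sub_mul, one_mul]
      nth_rewrite 2 [hone]
      rw [Finset.mul_sum, Finset.sum_mul, ← Finset.sum_sub_distrib]
      refine Finset.sum_congr rfl fun k _ => ?_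
      rw [mul_assoc (X * G - 1), ← mul_assoc (tail K n j N), htl, ← mul_assoc X, ← mul_assoc X, hcomm]
      simp only [mul_sub, sub_mul, mul_add, mul_one, one_mul, mul_assoc]
      abel
    rw [e]
    refine NegOn.sum fun k _ => NegOn.mul_left _ (hτ.mul_right ?_)
    exact mul_mem (hΦmem _ _) (mem_jacobianAlg hImem)

theorem exists_right_inverse {Φ : EndP K n ≃ₐ[K] EndP K n} (h : Normalizes Φ) (i : Fin n)
    (hG : ∃ G ∈ jacobianAlg K n, NegOn Finset.univ (Φ (opH K n i) * G - 1)) :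
    ∃ G ∈ jacobianAlg K n, Φ (opH K n i) * G = 1 := by
  have key : ∀ J : Finset (Fin n), (∃ G ∈ jacobianAlg K n, NegOn J (Φ (opH K n i) * G - 1)) →
      ∃ G ∈ jacobianAlg K n, Φ (opH K n i) * G = 1 := by
    intro J
    induction J using Finset.induction_on with
    | empty => exact fun ⟨G, hG, h0⟩ => ⟨G, hG, sub_eq_zero.1 (negOn_empty h0)⟩
    | insert j J _ ih => exact fun h' => ih (exists_right_inverse_step h i j J h')
  exact key _ hG

/-! ### Leading shifts of operators that are algebraic on slices -/

theorem exists_nat_eval_ne_zero {q : Polynomial K} (hq : q ≠ 0) :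
    ∃ N : ℕ, ∀ t : ℤ, (N : ℤ) ≤ t → q.eval (t : K) ≠ 0 := by
  have hfin : {t : ℤ | q.IsRoot (t : K)}.Finite :=
    (Polynomial.finite_setOfPred_isRoot hq).preimage Int.cast_injective.injOn
  obtain ⟨b, hb⟩ := hfin.bddAbove
  refine ⟨b.toNat + 1, fun t ht h => ?_⟩
  have := hb (show t ∈ {t : ℤ | q.IsRoot (t : K)} from h)
  push_cast at ht
  omega

theorem eval_line {σ : Type*} (g : σ → Polynomial K) (p : MvPolynomial σ K) (t : K) :
    (aeval g p : Polynomial K).eval t = eval (fun i => (g i).eval t) p := by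
  induction p using MvPolynomial.induction_on with
  | C a => simp
  | add p q hp hq => rw [map_add, map_add, Polynomial.eval_add, hp, hq]
  | mul_X p i hp => rw [map_mul, map_mul, Polynomial.eval_mul, hp, aeval_X, eval_X]

/-- Beyond the roots of `p` on one line in direction `j`, no restriction of `p` to a slice is zero.
As `β j ≥ 0`, the slices of `α + kβ` all lie there, and finitely many nonzero polynomials have a
common nonzero at large integers. -/
theorem exists_slice_eval_ne_zero {p : MvPolynomial (Fin n) K} (hp : p ≠ 0) (j : Fin n)
    {β : Fin n → ℤ} (hβ : 0 ≤ β j) :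
    ∃ M₀ : ℕ, ∀ M : ℕ, M₀ ≤ M → ∀ (L : ℕ) (R : ℤ), ∃ α : Fin n → ℤ, α j = (M : ℤ) ∧
      (∀ i, i ≠ j → R ≤ α i) ∧
      ∀ k < L, eval (fun i => (((α + (k : ℤ) • β) i : ℤ) : K)) p ≠ 0 := by
  obtain ⟨x, hx⟩ : ∃ x, eval x p ≠ 0 := by
    by_contra! h
    exact hp (MvPolynomial.funext fun x => by rw [h x, map_zero])
  set q : Polynomial K := aeval (fun i => if i = j then Polynomial.X else Polynomial.C (x i)) p with hq
  have hqe : ∀ t, q.eval t = eval (Function.update x j t) p := by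
    intro t
    rw [hq, eval_line]
    congr 2
    funext i
    by_cases hi : i = j
    · subst hi; simp
    · simp [hi]
  have hq0 : q ≠ 0 := by
    intro h
    have := hqe (x j)
    rw [h, Function.update_eq_self, Polynomial.eval_zero] at this
    exact hx this.symm
  obtain ⟨M₀, hM₀⟩ := exists_nat_eval_ne_zero hq0
  refine ⟨M₀, fun M hM L R => ?_⟩
  let P : ℕ → MvPolynomial (Fin n) K := fun k => aeval (fun i => if i = j
    then C (((M : ℤ) + k * β j : ℤ) : K) else X i + C ((k * β i : ℤ) : K)) p
  have hP : ∀ (k : ℕ) (y : Fin n → K), eval y (P k) = eval (fun i => if i = j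
      then (((M : ℤ) + k * β j : ℤ) : K) else y i + ((k * β i : ℤ) : K)) p := by
    intro k y
    rw [eval_aeval]
    congr 2
    funext i
    split_ifs <;> simp
  have hP0 : ∀ k, P k ≠ 0 := by
    intro k h
    have h1 := hP k fun i => x i - ((k * β i : ℤ) : K)
    rw [h, map_zero] at h1
    refine hM₀ ((M : ℤ) + k * β j) ?_ ?_
    · have : 0 ≤ (k : ℤ) * β j := mul_nonneg (Int.natCast_nonneg k) hβ
      omega
    · rw [hqe, h1]
      congr 2
      funext i
      by_cases hi : i = j
      · subst hi; simp
      · simp [hi]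
  have hprod : ∏ k ∈ Finset.range L, P k ≠ 0 := Finset.prod_ne_zero_iff.2 fun k _ => hP0 k
  obtain ⟨y, hy, hne⟩ : ∃ y ∈ Set.pi Set.univ (fun _ : Fin n => (fun t : ℤ => (t : K)) '' Set.Ici R),
      eval y (∏ k ∈ Finset.range L, P k) ≠ 0 := by
    by_contra! h
    exact hprod (MvPolynomial.funext_set _
      (fun _ => (Set.Ici_infinite R).image Int.cast_injective.injOn)
      fun y hy => by rw [h y hy, map_zero])
  choose z hz hzy using fun i => hy i (Set.mem_univ i)
  refine ⟨Function.update z j M, by simp, fun i hi => by simpa [hi] using hz i, fun k hk => ?_⟩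
  rw [map_prod, Finset.prod_ne_zero_iff] at hne
  have h1 := hne k (Finset.mem_range.2 hk)
  rw [hP] at h1
  convert h1 using 3
  funext i
  by_cases hi : i = j
  · subst hi; simp
  · simp [hi, ← hzy i]

/-- If the shift `β` of largest weight had positive weight, then modulo indices of lower weight `Y ^
k` would send `b α` to a nonzero multiple of `b (α + kβ)`. The top term of the monic relation `Q`
could then not cancel. The general `b` serves both the basis `dp` and the coordinates `cf`. -/
theorem leading_shift_nonpos {V : Type*} [AddCommGroup V] [Module K V] {b : (Fin n → ℤ) → V}
    (hb0 : ∀ γ, ¬ 0 ≤ γ → b γ = 0)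
    (hb : LinearIndependent K fun γ : {γ : Fin n → ℤ // 0 ≤ γ} => b γ)
    {Y : Module.End K V} {B : Finset (Fin n → ℤ)} {g : (Fin n → ℤ) → (Fin n → ℤ) → K}
    (hY : ∀ γ, 0 ≤ γ → Y (b γ) = ∑ β ∈ B, g β γ • b (γ + β))
    {p : (Fin n → ℤ) → MvPolynomial (Fin n) K} {N : ℕ}
    (hp : ∀ β ∈ B, ∀ γ : Fin n → ℤ, (∀ i, (N : ℤ) ≤ γ i) → g β γ = eval (fun i => (γ i : K)) (p β))
    {j : Fin n}
    (hQ : ∀ M : ℕ, ∃ Q : Polynomial K, Q.Monic ∧ ∀ γ, 0 ≤ γ → γ j = (M : ℤ) → Polynomial.aeval Y Q (b γ) = 0)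
    {Γ : Type*} [AddCommGroup Γ] [LinearOrder Γ] [IsOrderedAddMonoid Γ] {w : (Fin n → ℤ) →+ Γ}
    (hw : Function.Injective w) (hwj : ∀ β, β j < 0 → w β < 0) :
    ∀ β ∈ B, p β ≠ 0 → w β ≤ 0 := by
  intro β₀ hβ₀ hpβ₀
  by_contra hpos
  obtain ⟨β, hβ, hmax⟩ := Finset.exists_max_image (B.filter fun β => p β ≠ 0) w
    ⟨β₀, by simp [hβ₀, hpβ₀]⟩
  simp only [Finset.mem_filter] at hβ hmax
  have hwpos : 0 < w β := lt_of_lt_of_le (not_le.1 hpos) (hmax β₀ ⟨hβ₀, hpβ₀⟩)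
  have hβj : 0 ≤ β j := by
    by_contra h
    exact lt_asymm hwpos (hwj β (not_le.1 h))
  obtain ⟨C, hC⟩ := exists_band_bound B
  obtain ⟨M₀, hM₀⟩ := exists_slice_eval_ne_zero hβ.2 j hβj
  -- With `α j = M ≥ N + C`, an index that falls below `N` in direction `j`, where the coefficients
  -- are uncontrolled, is still below `α j` after one more step and so has negative relative weight.
  set M := max M₀ (N + C) with hM
  obtain ⟨Q, hQm, hQ0⟩ := hQ M
  set L := Q.natDegree with hL
  obtain ⟨α, hαj, hαi, hαp⟩ := hM₀ M (le_max_left _ _) L ((N : ℤ) + L * C)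
  have hM2 : (N : ℤ) + C ≤ M := by
    have := le_max_right M₀ (N + C)
    omega
  -- Error indices after `k` steps: of lower weight than the leading one, and with a margin of `C`
  -- off `j` for each of the remaining `L - k` steps.
  let S : ℕ → Set (Fin n → ℤ) := fun k =>
    {γ | 0 ≤ γ ∧ (∀ i, i ≠ j → (N : ℤ) + ((L : ℤ) - k) * C ≤ γ i) ∧ w (γ - α) < k • w β}
  let π : ℕ → K := fun k => ∏ l ∈ Finset.range k, eval (fun i => (((α + (l : ℤ) • β) i : ℤ) : K)) (p β)
  have hstep_low : ∀ k ≤ L, ∀ γ, γ ∈ S k → ∀ δ ∈ B, (p δ ≠ 0 ∨ γ j < N) → 0 ≤ γ + δ → γ + δ ∈ S (k + 1) := by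
    rintro k hk γ ⟨h0, hi, hlt⟩ δ hδ hor hnn
    refine ⟨hnn, fun i hij => ?_, ?_⟩
    · have h1 := hi i hij
      have h2 := (hC δ hδ i).1
      simp only [Pi.add_apply]
      push_cast
      linarith
    · by_cases hlow : γ j < N
      · have h2 := (hC δ hδ j).2
        refine lt_of_lt_of_le (hwj _ ?_) (nsmul_nonneg hwpos.le _)
        simp only [Pi.sub_apply, Pi.add_apply]
        omega
      · have hδp := hor.resolve_right hlow
        have e : γ + δ - α = (γ - α) + δ := by abel
        rw [e, map_add, succ_nsmul]
        exact add_lt_add_of_lt_of_le hlt (hmax δ ⟨hδ, hδp⟩)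
  have hα0 : ∀ k ≤ L, ∀ i, (N : ℤ) + ((L : ℤ) - k) * C ≤ (α + (k : ℤ) • β) i ∨ i = j := by
    intro k hk i
    by_cases hij : i = j
    · exact Or.inr hij
    · left
      have h1 := hαi i hij
      have h2 := (hC β hβ.1 i).1
      simp only [Pi.add_apply, Pi.smul_apply, smul_eq_mul]
      nlinarith [Int.natCast_nonneg k]
  have hαN : ∀ k ≤ L, ∀ i, (N : ℤ) ≤ (α + (k : ℤ) • β) i := by
    intro k hk i
    rcases hα0 k hk i with h | rfl
    · have : 0 ≤ ((L : ℤ) - k) * C := mul_nonneg (by omega) (Int.natCast_nonneg C)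
      omega
    · have : 0 ≤ (k : ℤ) * β i := mul_nonneg (Int.natCast_nonneg k) hβj
      simp only [Pi.add_apply, Pi.smul_apply, smul_eq_mul]
      omega
  have hαnn : ∀ k ≤ L, 0 ≤ α + (k : ℤ) • β := fun k hk i => (Int.natCast_nonneg N).trans (hαN k hk i)
  have claim : ∀ k ≤ L, (Y ^ k) (b α) - π k • b (α + (k : ℤ) • β) ∈ Submodule.span K (b '' S k) := by
    intro k
    induction k with
    | zero => intro _; simp [π]
    | succ k ih =>
      intro hk
      have hk' : k ≤ L := by omega
      have h1 := ih hk'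
      have h2 : Submodule.map Y (Submodule.span K (b '' S k)) ≤ Submodule.span K (b '' S (k + 1)) := by
        rw [Submodule.map_span_le]
        rintro _ ⟨γ, hγ, rfl⟩
        rw [hY γ hγ.1]
        refine sum_mem fun δ hδ => ?_
        by_cases hnn : 0 ≤ γ + δ
        swap
        · rw [hb0 _ hnn, smul_zero]; exact zero_mem _
        by_cases hor : p δ ≠ 0 ∨ γ j < N
        · exact Submodule.smul_mem _ _ (Submodule.subset_span
            ⟨_, hstep_low k hk' γ hγ δ hδ hor hnn, rfl⟩)
        · push Not at hor
          rw [hp δ hδ γ, hor.1, map_zero, zero_smul]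
          · exact zero_mem _
          · intro i
            by_cases hij : i = j
            · subst hij; exact hor.2
            · have := hγ.2.1 i hij
              have : 0 ≤ ((L : ℤ) - k) * C := mul_nonneg (by omega) (Int.natCast_nonneg C)
              omega
      have h3 : Y (b (α + (k : ℤ) • β)) - eval (fun i => (((α + (k : ℤ) • β) i : ℤ) : K)) (p β) •
          b (α + ((k + 1 : ℕ) : ℤ) • β) ∈ Submodule.span K (b '' S (k + 1)) := by
        have e1 : α + ((k + 1 : ℕ) : ℤ) • β = α + (k : ℤ) • β + β := by
          push_cast; rw [add_smul, one_smul, add_assoc]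
        rw [hY _ (hαnn k hk'), ← Finset.add_sum_erase _ _ hβ.1, hp β hβ.1 _ (hαN k hk'), e1,
          add_sub_cancel_left]
        refine sum_mem fun δ hδ => ?_
        obtain ⟨hne, hδ⟩ := Finset.mem_erase.1 hδ
        rw [hp δ hδ _ (hαN k hk')]
        by_cases hpδ : p δ = 0
        · rw [hpδ, map_zero, zero_smul]; exact zero_mem _
        by_cases hnn : 0 ≤ α + (k : ℤ) • β + δ
        swap
        · rw [hb0 _ hnn, smul_zero]; exact zero_mem _
        refine Submodule.smul_mem _ _ (Submodule.subset_span ⟨_, ⟨hnn, fun i hij => ?_, ?_⟩, rfl⟩)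
        · have h4 := (hα0 k hk' i).resolve_right hij
          have h5 := (hC δ hδ i).1
          rw [Pi.add_apply]
          push_cast
          linarith
        · have e2 : α + (k : ℤ) • β + δ - α = k • β + δ := by
            rw [natCast_zsmul]; abel
          rw [e2, map_add, map_nsmul, succ_nsmul]
          refine add_lt_add_of_le_of_lt le_rfl ?_
          exact lt_of_le_of_ne (hmax δ ⟨hδ, hpδ⟩) fun h => hne (hw h)
      have h4 := add_mem (h2 ⟨_, h1, rfl⟩) (Submodule.smul_mem _ (π k) h3)
      convert h4 using 1
      rw [map_sub, map_smul, smul_sub, smul_smul, pow_succ', Module.End.mul_apply]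
      simp only [π, Finset.prod_range_succ]
      abel
  have hαmem : 0 ≤ α := by simpa using hαnn 0 (Nat.zero_le _)
  have hzero := hQ0 α hαmem hαj
  let T : Set (Fin n → ℤ) := {γ | 0 ≤ γ ∧ w (γ - α) < L • w β}
  have hST : ∀ k ≤ L, S k ⊆ T := fun k hk γ hγ =>
    ⟨hγ.1, hγ.2.2.trans_le (nsmul_le_nsmul_left hwpos.le hk)⟩
  have hlow : ∀ k < L, (Y ^ k) (b α) ∈ Submodule.span K (b '' T) := by
    intro k hk
    have h1 := Submodule.span_mono (Set.image_mono (hST k hk.le)) (claim k hk.le)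
    have h2 : b (α + (k : ℤ) • β) ∈ Submodule.span K (b '' T) := by
      refine Submodule.subset_span ⟨_, ⟨hαnn k hk.le, ?_⟩, rfl⟩
      rw [add_sub_cancel_left, natCast_zsmul, map_nsmul]
      exact nsmul_lt_nsmul_left hwpos hk
    have := add_mem h1 (Submodule.smul_mem _ (π k) h2)
    rwa [sub_add_cancel] at this
  rw [Polynomial.aeval_eq_sum_range, LinearMap.sum_apply, Finset.sum_range_succ,
    ← hL, show Q.coeff L = 1 from hQm, one_smul] at hzero
  have htop : π L • b (α + (L : ℤ) • β) ∈ Submodule.span K (b '' T) := by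
    have h1 := Submodule.span_mono (Set.image_mono (hST L le_rfl)) (claim L le_rfl)
    have h2 : (Y ^ L) (b α) ∈ Submodule.span K (b '' T) := by
      rw [eq_neg_of_add_eq_zero_right hzero]
      refine neg_mem (sum_mem fun k hk => ?_)
      rw [LinearMap.smul_apply]
      exact Submodule.smul_mem _ _ (hlow k (Finset.mem_range.1 hk))
    have := sub_mem h2 h1
    rwa [sub_sub_cancel] at this
  have hπ : π L ≠ 0 := Finset.prod_ne_zero_iff.2 fun l hl => hαp l (Finset.mem_range.1 hl)
  have htop' := (Submodule.smul_mem_iff _ hπ).1 htop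
  have himg : b '' T = (fun γ : {γ : Fin n → ℤ // 0 ≤ γ} => b γ) '' {γ | (γ : Fin n → ℤ) ∈ T} := by
    ext v
    constructor
    · rintro ⟨γ, hγ, rfl⟩
      exact ⟨⟨γ, hγ.1⟩, hγ, rfl⟩
    · rintro ⟨γ, hγ, rfl⟩
      exact ⟨γ, hγ, rfl⟩
  rw [himg] at htop'
  refine hb.notMem_span_image (x := ⟨_, hαnn L le_rfl⟩) ?_ htop'
  rintro ⟨-, h⟩
  rw [add_sub_cancel_left, natCast_zsmul, map_nsmul] at h
  exact lt_irrefl _ h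

/-! ### Eigenvalues and inverses of the elements `(H_i + a)_*` -/

/-- The replacement of `0` by `1`: the eigenvalues of `(H_i + a)_*` are its values at `α_i + 1 + a`. -/
def star (K : Type*) [Field K] (z : ℤ) : K := if z = 0 then 1 else (z : K)

theorem star_ne_zero (z : ℤ) : star K z ≠ 0 := by
  unfold star
  split_ifs with h
  · exact one_ne_zero
  · exact Int.cast_ne_zero.2 h

theorem hStar_dp (i : Fin n) (a : ℤ) {γ : Fin n → ℤ} (hγ : 0 ≤ γ) :
    hStar K n i a (dp K n γ) = star K (γ i + 1 + a) • dp K n γ := by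
  have h0 := hγ i
  simp only [Pi.zero_apply] at h0
  cases a with
  | ofNat a =>
    have h1 : γ i + 1 + Int.ofNat a ≠ 0 := by simp only [Int.ofNat_eq_natCast]; omega
    rw [star, if_neg h1, hStar, LinearMap.add_apply, opH_dp i hγ, Module.End.natCast_apply,
      ← Nat.cast_smul_eq_nsmul K, ← add_smul]
    simp
  | negSucc k =>
    rw [hStar, LinearMap.add_apply, LinearMap.sub_apply, opH_dp i hγ, Module.End.natCast_apply,
      matUnit_dp i k k hγ, ← Nat.cast_smul_eq_nsmul K, ← sub_smul, star]
    have e : γ i + 1 + Int.negSucc k = γ i - k := by rw [Int.negSucc_eq]; ring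
    rw [e]
    by_cases h : γ i = k
    · rw [if_pos h, if_pos (by omega), ← h, Function.update_eq_self, h]
      simp
    · rw [if_neg h, if_neg (by omega), add_zero]
      congr 1
      push_cast
      ring

/-- Conjugating `H_i⁻¹` by shifts translates its eigenvalue. For negative `a` the shifts kill the
lowest exponents, and matrix units supply these finitely many eigenvalues. -/
theorem exists_hStar_inverse (i : Fin n) (a : ℤ) :
    ∃ G ∈ jacobianAlg K n, ∀ γ, 0 ≤ γ → G (dp K n γ) = (star K (γ i + 1 + a))⁻¹ • dp K n γ := by
  cases a with
  | ofNat a =>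
    refine ⟨del K n i ^ a * (opHInv K n i * integ K n i ^ a),
      mul_mem (pow_mem (mem_jacobianAlg (del_mem i)) _) (mul_mem (opHInv_mem i)
        (pow_mem (mem_jacobianAlg (integ_mem i)) _)), fun γ hγ => ?_⟩
    have h0 := hγ i
    simp only [Pi.zero_apply] at h0
    have hnn : 0 ≤ γ + Pi.single i (a : ℤ) :=
      add_nonneg hγ (Pi.single_nonneg.2 (Int.natCast_nonneg a))
    have h1 : γ i + 1 + Int.ofNat a ≠ 0 := by simp only [Int.ofNat_eq_natCast]; omega
    rw [Module.End.mul_apply, Module.End.mul_apply, integ_pow_dp i a hγ, opHInv_dp i hnn, map_smul,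
      del_pow_dp i a hnn, add_sub_cancel_right, star, if_neg h1]
    congr 2
    simp
    ring
  | negSucc k =>
    refine ⟨integ K n i ^ (k + 1) * (opHInv K n i * del K n i ^ (k + 1)) +
        ∑ s ∈ Finset.range (k + 1), (star K ((s : ℤ) - k))⁻¹ • matUnit K n i s s,
      add_mem (mul_mem (pow_mem (mem_jacobianAlg (integ_mem i)) _) (mul_mem (opHInv_mem i)
        (pow_mem (mem_jacobianAlg (del_mem i)) _)))
        (sum_mem fun s _ => Subalgebra.smul_mem _ (mem_jacobianAlg (matUnit_mem i s s)) _),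
      fun γ hγ => ?_⟩
    have h0 := hγ i
    simp only [Pi.zero_apply] at h0
    have e : γ i + 1 + Int.negSucc k = γ i - k := by rw [Int.negSucc_eq]; ring
    rw [LinearMap.add_apply, sum_smul_matUnit_dp i _ (fun s => (star K ((s : ℤ) - k))⁻¹) hγ,
      Module.End.mul_apply, Module.End.mul_apply, del_pow_dp i _ hγ, e]
    by_cases h : 0 ≤ γ - Pi.single i ((k + 1 : ℕ) : ℤ)
    · have h1 := (sub_single_nonneg_iff hγ i _).1 h
      rw [opHInv_dp i h, map_smul, integ_pow_dp i _ h, sub_add_cancel, if_neg (by omega), add_zero,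
        star, if_neg (by omega)]
      congr 2
      simp only [Pi.sub_apply, Pi.single_eq_same]
      push_cast
      ring
    · have h1 := mt (sub_single_nonneg_iff hγ i _).2 h
      rw [dp_of_not_nonneg h, map_zero, map_zero, zero_add, if_pos (by omega), Int.toNat_of_nonneg h0]

theorem aeval_apply_of_eigen {V : Type*} [AddCommGroup V] [Module K V] {Y : Module.End K V} {v : V}
    {μ : K} (h : Y v = μ • v) (Q : Polynomial K) : Polynomial.aeval Y Q v = Q.eval μ • v := by
  induction Q using Polynomial.induction_on with
  | C a => simp [Module.algebraMap_end_apply]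
  | add p q hp hq => rw [map_add, LinearMap.add_apply, hp, hq, Polynomial.eval_add, add_smul]
  | monomial k a ih =>
    rw [pow_succ, ← mul_assoc, map_mul, Polynomial.aeval_X, Module.End.mul_apply, h, map_smul, ih,
      smul_smul, mul_comm μ, ← Polynomial.eval_mul_X]

theorem aeval_dualMap {V : Type*} [AddCommGroup V] [Module K V] (Y : Module.End K V)
    (f : Module.Dual K V) (Q : Polynomial K) :
    Polynomial.aeval (Y.dualMap : Module.End K (Module.Dual K V)) Q f
      = f ∘ₗ (Polynomial.aeval Y Q) := by
  induction Q using Polynomial.induction_on generalizing f with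
  | C a => ext v; simp [Module.algebraMap_end_apply]
  | add p q hp hq => rw [map_add, LinearMap.add_apply, hp, hq, map_add, LinearMap.comp_add]
  | monomial k a ih =>
    have e : Polynomial.C a * Polynomial.X ^ (k + 1)
        = Polynomial.X * (Polynomial.C a * Polynomial.X ^ k) := by ring
    have h1 := ih (Y.dualMap f)
    have h2 : Polynomial.aeval Y (Polynomial.X * (Polynomial.C a * Polynomial.X ^ k))
        = Y * Polynomial.aeval Y (Polynomial.C a * Polynomial.X ^ k) := by
      rw [map_mul, Polynomial.aeval_X]
    rw [e, h2, mul_comm Polynomial.X, map_mul, Polynomial.aeval_X, Module.End.mul_apply, h1]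
    rfl

/-! ### The form of `Φ(H_i)` far from the walls -/

/-- The weight of a lattice vector: the `j`-th entry first, ties broken lexicographically. -/
def lexWeight (j : Fin n) : (Fin n → ℤ) →+ ℤ ×ₗ Lex (Fin n → ℤ) where
  toFun β := toLex (β j, toLex β)
  map_zero' := rfl
  map_add' _ _ := rfl

theorem lexWeight_injective (j : Fin n) : Function.Injective (lexWeight j) := fun _ _ h =>
  toLex.injective (congrArg (fun x => (ofLex x).2) h)

theorem lexWeight_neg {j : Fin n} {β : Fin n → ℤ} (h : β j < 0) : lexWeight j β < 0 :=
  Prod.Lex.toLex_lt_toLex.2 (Or.inl h)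

/-- The polynomial `∏_{k < L} (t - (k + 1))`. -/
def rootPoly (K : Type*) [Field K] (L : ℕ) : Polynomial K :=
  ∏ k ∈ Finset.range L, (Polynomial.X - Polynomial.C ((k : K) + 1))

theorem rootPoly_monic (L : ℕ) : (rootPoly K L).Monic :=
  Polynomial.monic_prod_of_monic _ _ fun k _ => Polynomial.monic_X_sub_C _

theorem rootPoly_eval_eq_zero_iff (L : ℕ) (t : K) :
    (rootPoly K L).eval t = 0 ↔ ∃ k < L, t = (k : K) + 1 := by
  rw [rootPoly, Polynomial.eval_prod, Finset.prod_eq_zero_iff]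
  simp [sub_eq_zero]

theorem aeval_opH_rootPoly_dp (i : Fin n) (L : ℕ) {γ : Fin n → ℤ} (hγ : 0 ≤ γ) (h : γ i < L) :
    Polynomial.aeval (opH K n i) (rootPoly K L) (dp K n γ) = 0 := by
  have h0 := hγ i
  simp only [Pi.zero_apply] at h0
  rw [aeval_apply_of_eigen (opH_dp i hγ), (rootPoly_eval_eq_zero_iff _ _).2, zero_smul]
  refine ⟨(γ i).toNat, by omega, ?_⟩
  rw [← Int.cast_natCast, Int.toNat_of_nonneg h0]

theorem aeval_opH_rootPoly_mul (i : Fin n) (L : ℕ) :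
    Polynomial.aeval (opH K n i) (rootPoly K L) * (1 - tail K n i L) = 0 := by
  refine end_ext fun γ hγ => ?_
  rw [Module.End.mul_apply, LinearMap.sub_apply, tail_dp i L hγ, Module.End.one_apply]
  split_ifs with h
  · rw [sub_self, map_zero]; rfl
  · rw [sub_zero, aeval_opH_rootPoly_dp i L hγ (by omega)]; rfl

theorem mul_aeval_opH_rootPoly (i : Fin n) (L : ℕ) :
    (1 - tail K n i L) * Polynomial.aeval (opH K n i) (rootPoly K L) = 0 := by
  refine end_ext fun γ hγ => ?_
  rw [Module.End.mul_apply, aeval_apply_of_eigen (opH_dp i hγ), map_smul, LinearMap.sub_apply,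
    tail_dp i L hγ, Module.End.one_apply]
  split_ifs with h
  · rw [sub_self, smul_zero]; rfl
  · rw [sub_zero, ← aeval_apply_of_eigen (opH_dp i hγ), aeval_opH_rootPoly_dp i L hγ (by omega)]; rfl

/-- The projection `e` onto exponents `γ j ≤ M` lies in `p_j`. Its preimage in `p_i` lives on
`i`-exponents below some `L`, where `rootPoly K L` kills `H_i`; multiplying on either side gives the
statements for columns and rows. -/
theorem Normalizes.exists_rootPoly {Φ : EndP K n ≃ₐ[K] EndP K n} (h : Normalizes Φ) {i j : Fin n}
    (hij : MapsPrime Φ.symm j i) (M : ℕ) :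
    ∃ L, (∀ γ, 0 ≤ γ → γ j = (M : ℤ) →
        Polynomial.aeval (Φ (opH K n i)) (rootPoly K L) (dp K n γ) = 0) ∧
      ∀ γ, 0 ≤ γ → γ j = (M : ℤ) →
        cf K n γ ∘ₗ Polynomial.aeval (Φ (opH K n i)) (rootPoly K L) = 0 := by
  set e : EndP K n := 1 - tail K n j (M + 1) with he
  have hemem : e ∈ intDiffAlg K n := sub_mem (one_mem _) (tail_mem j _)
  set u := Φ.symm e with hu
  have hΦu : Φ u = e := Φ.apply_symm_apply _
  have humem : u ∈ intDiffAlg K n := (h.symm.mem_iff _).2 hemem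
  have huneg : NegOn {i} u := hij _ hemem (negOn_one_sub_tail j _)
  obtain ⟨L₁, hL₁⟩ := huneg.exists_tail_mul_eq_zero (mem_jacobianAlg humem)
  obtain ⟨L₂, hL₂⟩ := huneg.exists_mul_tail_eq_zero
  set L := max L₁ L₂
  have hlu : u = (1 - tail K n i L) * u := by
    rw [sub_mul, one_mul, hL₁ L (le_max_left _ _), sub_zero]
  have hru : u = u * (1 - tail K n i L) := by
    rw [mul_sub, mul_one, hL₂ L (le_max_right _ _), sub_zero]
  have hae : Polynomial.aeval (Φ (opH K n i)) (rootPoly K L)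
      = Φ (Polynomial.aeval (opH K n i) (rootPoly K L)) :=
    Polynomial.aeval_algHom_apply Φ.toAlgHom _ _
  have h1 : Polynomial.aeval (Φ (opH K n i)) (rootPoly K L) * e = 0 := by
    rw [hae, ← hΦu, hlu, ← map_mul, ← mul_assoc, aeval_opH_rootPoly_mul, zero_mul, map_zero]
  have h2 : e * Polynomial.aeval (Φ (opH K n i)) (rootPoly K L) = 0 := by
    rw [hae, ← hΦu, hru, ← map_mul, mul_assoc, mul_aeval_opH_rootPoly, mul_zero, map_zero]
  refine ⟨L, fun γ hγ hj => ?_, fun γ hγ hj => ?_⟩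
  · have h3 : e (dp K n γ) = dp K n γ := by
      rw [he, LinearMap.sub_apply, tail_dp j _ hγ, if_neg (by push_cast; omega), sub_zero,
        Module.End.one_apply]
    rw [← h3, ← Module.End.mul_apply, h1, LinearMap.zero_apply]
  · have h3 : cf K n γ ∘ₗ e = cf K n γ := by
      refine dual_ext fun δ hδ => ?_
      rw [LinearMap.comp_apply, he, LinearMap.sub_apply, tail_dp j _ hδ, Module.End.one_apply]
      split_ifs with hδj
      · rw [sub_self, map_zero, cf_dp hδ, if_neg]
        rintro rfl
        push_cast at hδj
        omega
      · rw [sub_zero]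
    rw [← h3, LinearMap.comp_assoc, ← Module.End.mul_eq_comp, h2, LinearMap.comp_zero]

theorem exists_corner_rep {a : EndP K n} (ha : a ∈ intDiffAlg K n) :
    ∃ (B : Finset (Fin n → ℤ)) (f : (Fin n → ℤ) → (Fin n → ℤ) → K)
      (p : (Fin n → ℤ) → MvPolynomial (Fin n) K) (N : ℕ),
      (∀ γ, 0 ≤ γ → a (dp K n γ) = ∑ β ∈ B, f β γ • dp K n (γ + β)) ∧
      ∀ β ∈ B, ∀ γ : Fin n → ℤ, (∀ i, (N : ℤ) ≤ γ i) → f β γ = eval (fun i => (γ i : K)) (p β) := by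
  obtain ⟨B, f, hf, hrep⟩ := exists_band_rep (intDiffAlg_le_bandAlg ha)
  choose N p hp using fun β => (hf β).2
  refine ⟨B, f, p, B.sup N, hrep, fun β hβ γ hγ => hp β γ fun i => ?_⟩
  have : N β ≤ B.sup N := Finset.le_sup hβ
  have := hγ i
  omega

theorem aeval_translate_ne_zero {p : MvPolynomial (Fin n) K} (hp : p ≠ 0) (c : Fin n → K) :
    (aeval (fun i => X i + C (c i)) p : MvPolynomial (Fin n) K) ≠ 0 := by
  intro h
  refine hp (MvPolynomial.funext fun x => ?_)
  have h1 := eval_aeval (fun i => x i - c i) (fun i => X i + C (c i)) p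
  rw [h, map_zero] at h1
  rw [map_zero, h1]
  congr 2
  funext i
  simp

/-- Transposition reverses every shift and evaluates its coefficient at the source index; this makes
`leading_shift_nonpos` applicable to rows. -/
theorem dual_rep {a : EndP K n} {B : Finset (Fin n → ℤ)} {f : (Fin n → ℤ) → (Fin n → ℤ) → K}
    (hrep : ∀ γ, 0 ≤ γ → a (dp K n γ) = ∑ β ∈ B, f β γ • dp K n (γ + β)) (γ : Fin n → ℤ) (hγ : 0 ≤ γ) :
    a.dualMap (cf K n γ) = ∑ β ∈ B.image Neg.neg, f (-β) (γ + β) • cf K n (γ + β) := by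
  refine dual_ext fun α hα => ?_
  rw [LinearMap.dualMap_apply, hrep α hα, map_sum, LinearMap.sum_apply,
    Finset.sum_image neg_injective.injOn]
  refine Finset.sum_congr rfl fun β hβ => ?_
  rw [map_smul, LinearMap.smul_apply, neg_neg, cf_dp hα]
  by_cases hnn : 0 ≤ α + β
  · rw [cf_dp hnn]
    by_cases e : γ = α + β
    · subst e; simp
    · rw [if_neg e, if_neg, smul_zero, smul_zero]
      rintro rfl
      exact e (by abel)
  · rw [dp_of_not_nonneg hnn, map_zero, if_neg, smul_zero, smul_zero]
    rintro rfl
    exact hnn (by simpa using hγ)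

/-- A shift `β` with nonzero corner polynomial has weight at most zero by columns, and `-β` does by
rows. The weight is injective, so `β = 0`. -/
theorem Normalizes.exists_diagonal {Φ : EndP K n ≃ₐ[K] EndP K n} (h : Normalizes Φ) {i j : Fin n}
    (hij : MapsPrime Φ.symm j i) :
    ∃ (c : MvPolynomial (Fin n) K) (N : ℕ), ∀ γ : Fin n → ℤ, (∀ l, (N : ℤ) ≤ γ l) →
      Φ (opH K n i) (dp K n γ) = eval (fun l => (γ l : K)) c • dp K n γ := by
  set X := Φ (opH K n i) with hX
  obtain ⟨B, f, p, N, hrep, hp⟩ := exists_corner_rep ((h.mem_iff _).2 (opH_mem i))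
  obtain ⟨C, hC⟩ := exists_band_bound B
  have hcol : ∀ β ∈ B, p β ≠ 0 → lexWeight j β ≤ 0 :=
    leading_shift_nonpos (fun γ => dp_of_not_nonneg) dp_linearIndependent hrep hp
      (fun M => by
        obtain ⟨L, hL, -⟩ := h.exists_rootPoly hij M
        exact ⟨_, rootPoly_monic L, hL⟩)
      (lexWeight_injective j) (fun β => lexWeight_neg)
  have hrow : ∀ β ∈ B.image Neg.neg, (aeval (fun l => MvPolynomial.X l + MvPolynomial.C (β l : K))
      (p (-β)) : MvPolynomial (Fin n) K) ≠ 0 → lexWeight j β ≤ 0 := by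
    refine leading_shift_nonpos (V := Module.Dual K (MvPolynomial (Fin n) K)) (b := cf K n)
      (Y := LinearMap.dualMap X) (B := B.image Neg.neg)
      (g := fun β γ => f (-β) (γ + β)) (N := N + C)
      (p := fun β => aeval (fun l => MvPolynomial.X l + MvPolynomial.C (β l : K)) (p (-β)))
      (fun γ h0 => cf_of_not_nonneg h0) cf_linearIndependent ?_ ?_ ?_ (lexWeight_injective j)
      (fun β hβ => lexWeight_neg hβ)
    · intro γ hγ
      exact dual_rep hrep γ hγ
    · intro β hβ γ hN
      obtain ⟨δ, hδ, rfl⟩ := Finset.mem_image.1 hβ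
      rw [neg_neg, hp δ hδ _ fun l => ?_, eval_aeval]
      · simp
      · have := (hC δ hδ l).2
        have := hN l
        simp only [Pi.add_apply, Pi.neg_apply]
        omega
    · intro M
      obtain ⟨L, -, hL⟩ := h.exists_rootPoly hij M
      exact ⟨_, rootPoly_monic L, fun γ hγ hM => by rw [aeval_dualMap, hL γ hγ hM]⟩
  have hzero : ∀ β ∈ B, β ≠ 0 → p β = 0 := by
    intro β hβ hne
    by_contra hpβ
    have h1 := hcol β hβ hpβ
    have h2 := hrow (-β) (Finset.mem_image_of_mem _ hβ) (by
      rw [neg_neg]; exact aeval_translate_ne_zero hpβ _)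
    rw [map_neg, Left.neg_nonpos_iff] at h2
    exact hne (lexWeight_injective j ((le_antisymm h1 h2).trans (map_zero _).symm))
  refine ⟨if 0 ∈ B then p 0 else 0, N, fun γ hγ => ?_⟩
  have hnn : 0 ≤ γ := fun l => (Int.natCast_nonneg N).trans (hγ l)
  rw [hrep γ hnn]
  split_ifs with h0
  · rw [Finset.sum_eq_single_of_mem 0 h0, hp 0 h0 γ hγ, add_zero]
    intro β hβ hne
    rw [hp β hβ γ hγ, hzero β hβ hne, map_zero, zero_smul]
  · rw [map_zero, zero_smul]
    refine Finset.sum_eq_zero fun β hβ => ?_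
    rw [hp β hβ γ hγ, hzero β hβ (fun e => h0 (e ▸ hβ)), map_zero, zero_smul]

theorem smul_dp_eq_zero {γ : Fin n → ℤ} (hγ : 0 ≤ γ) {c : K} (h : c • dp K n γ = 0) : c = 0 := by
  have := congrArg (cf K n γ) h
  rwa [map_smul, cf_dp_self hγ, map_zero, smul_eq_mul, mul_one] at this

theorem eq_C_of_comp_eq_zero {Q q : Polynomial K} (hQ : Q ≠ 0)
    (h : ∀ s : ℕ, Q.eval (q.eval (s : K)) = 0) (s t : K) : q.eval s = q.eval t := by
  have h1 : Q.comp q = 0 := by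
    refine Polynomial.eq_zero_of_infinite_isRoot _ ?_
    refine (Set.infinite_range_of_injective (Nat.cast_injective (R := K))).mono ?_
    rintro _ ⟨s, rfl⟩
    rw [Set.mem_ofPred_eq, Polynomial.IsRoot, Polynomial.eval_comp, h]
  rcases Polynomial.comp_eq_zero_iff.1 h1 with h2 | ⟨-, h2⟩
  · exact absurd h2 hQ
  · rw [h2, Polynomial.eval_C, Polynomial.eval_C]

theorem not_negOn_univ_one : ¬ NegOn Finset.univ (1 : EndP K n) := by
  rintro ⟨N, hN⟩
  have h0 : 0 ≤ fun _ : Fin n => (N : ℤ) := fun _ => Int.natCast_nonneg N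
  have := hN _ h0 (fun _ _ => le_rfl)
  rw [Module.End.one_apply, ← one_smul K (dp K n _)] at this
  exact one_ne_zero (smul_dp_eq_zero h0 this)

theorem del_mul_integ (i : Fin n) : del K n i * integ K n i = 1 :=
  end_ext fun γ hγ => by rw [Module.End.mul_apply, integ_dp i hγ, del_dp_add i hγ]; rfl

theorem del_mul_opH_sub (i : Fin n) : del K n i * opH K n i - opH K n i * del K n i = del K n i := by
  refine end_ext fun γ hγ => ?_
  rw [LinearMap.sub_apply, Module.End.mul_apply, Module.End.mul_apply, opH_dp i hγ, map_smul,
    del_dp i hγ]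
  by_cases h : 0 ≤ γ - Pi.single i 1
  · rw [opH_dp i h, ← sub_smul]
    simp
  · rw [dp_of_not_nonneg h, map_zero, smul_zero, sub_self]

/-- The difference equation makes `D` affine with slope `-1/r`; positive integer values at large
integers leave only `r = -1`. -/
theorem exists_eq_add_of_difference_eq {D : Polynomial K} {N : ℕ} {r : ℤ}
    (hpos : ∀ t : ℤ, (N : ℤ) ≤ t → ∃ k : ℕ, D.eval (t : K) = (k : K) + 1)
    (hdiff : ∀ t : K, D.eval t - D.eval (t + r) = 1) : ∃ b : ℤ, ∀ t : K, D.eval t = t + b := by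
  have hk : ∀ (k : ℕ) (t : K), D.eval (t + k * r) = D.eval t - k := by
    intro k t
    induction k with
    | zero => simp
    | succ k ih =>
      have := hdiff (t + k * r)
      rw [ih] at this
      have e : t + ((k + 1 : ℕ) : K) * r = t + k * r + r := by push_cast; ring
      rw [e]
      push_cast
      linear_combination -this
  obtain ⟨a, ha⟩ := hpos N le_rfl
  -- For `r ≥ 0` the values `D(N + k r) = D(N) - k` would eventually cease to be positive.
  have hr : r < 0 := by
    by_contra hr
    have h1 := hk (a + 1) (N : ℤ)
    rw [ha] at h1
    obtain ⟨m, hm⟩ := hpos (N + (a + 1 : ℕ) * r) (by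
      have : 0 ≤ ((a + 1 : ℕ) : ℤ) * r := mul_nonneg (Int.natCast_nonneg _) (not_lt.1 hr)
      omega)
    have e : (((N : ℤ) + (a + 1 : ℕ) * r : ℤ) : K) = ((N : ℤ) : K) + ((a + 1 : ℕ) : K) * r := by
      push_cast; ring
    rw [e, h1] at hm
    have h2 : ((m + 1 : ℕ) : K) = 0 := by push_cast; rw [← hm]; push_cast; ring
    exact Nat.cast_ne_zero.2 (Nat.succ_ne_zero m) h2
  have hlin : ∀ t : K, (r : K) * D.eval t = r * D.eval 0 - t := by
    have hE : Polynomial.C (r : K) * D + Polynomial.X - Polynomial.C (r * D.eval 0) = 0 := by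
      refine Polynomial.eq_zero_of_infinite_isRoot _ ?_
      have hinj : Function.Injective fun k : ℕ => (k : K) * r := fun k l hkl =>
        Nat.cast_injective (mul_right_cancel₀ (Int.cast_ne_zero.2 hr.ne) hkl)
      refine (Set.infinite_range_of_injective hinj).mono ?_
      rintro _ ⟨k, rfl⟩
      have := hk k 0
      rw [zero_add] at this
      simp only [Set.mem_ofPred_eq, Polynomial.IsRoot, Polynomial.eval_sub, Polynomial.eval_add,
        Polynomial.eval_mul, Polynomial.eval_C, Polynomial.eval_X, this]
      ring
    intro t
    have := congrArg (Polynomial.eval t) hE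
    simp only [Polynomial.eval_sub, Polynomial.eval_add, Polynomial.eval_mul, Polynomial.eval_C,
      Polynomial.eval_X, Polynomial.eval_zero] at this
    linear_combination this
  obtain ⟨m, hm⟩ := hpos (N + 1) (by omega)
  have h1 : r * ((m : ℤ) - a) = -1 := by
    have h2 := hlin ((N + 1 : ℤ) : K)
    have h3 := hlin ((N : ℤ) : K)
    rw [hm] at h2
    rw [ha] at h3
    have h4 : ((r * ((m : ℤ) - a) : ℤ) : K) = ((-1 : ℤ) : K) := by
      push_cast at *
      linear_combination h2 - h3
    exact Int.cast_injective h4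
  have hr1 : r = -1 := by
    rcases Int.eq_one_or_neg_one_of_mul_eq_neg_one h1 with h | h <;> omega
  subst hr1
  refine ⟨a + 1 - N, fun t => ?_⟩
  have h2 := hlin t
  have h3 := hlin ((N : ℤ) : K)
  rw [ha] at h3
  push_cast at *
  linear_combination h3 - h2

theorem Normalizes.exists_shift {Φ : EndP K n ≃ₐ[K] EndP K n} (h : Normalizes Φ) {i j : Fin n}
    (hij : MapsPrime Φ.symm j i) :
    ∃ (b : ℤ) (N : ℕ), ∀ γ : Fin n → ℤ, (∀ l, (N : ℤ) ≤ γ l) →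
      Φ (opH K n i) (dp K n γ) = ((γ j : K) + b) • dp K n γ := by
  obtain ⟨c, N, hc⟩ := h.exists_diagonal hij
  set X := Φ (opH K n i) with hX
  have hnn : ∀ γ : Fin n → ℤ, (∀ l, (N : ℤ) ≤ γ l) → 0 ≤ γ := fun γ hγ l =>
    (Int.natCast_nonneg N).trans (hγ l)
  have hroot : ∀ M : ℕ, ∃ L, ∀ γ : Fin n → ℤ, (∀ l, (N : ℤ) ≤ γ l) → γ j = (M : ℤ) →
      (rootPoly K L).eval (eval (fun l => (γ l : K)) c) = 0 := by
    intro M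
    obtain ⟨L, hL, -⟩ := h.exists_rootPoly hij M
    refine ⟨L, fun γ hγ hM => smul_dp_eq_zero (hnn γ hγ) ?_⟩
    rw [← aeval_apply_of_eigen (hc γ hγ), hL γ (hnn γ hγ) hM]
  -- Moving inside one slice, the eigenvalue is a polynomial in the step count with all values among
  -- the roots of one `rootPoly`, hence constant.
  have hadd : ∀ γ d : Fin n → ℤ, (∀ l, (N : ℤ) ≤ γ l) → 0 ≤ d → d j = 0 →
      eval (fun l => ((γ + d) l : K)) c = eval (fun l => (γ l : K)) c := by
    intro γ d hγ hd hdj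
    obtain ⟨L, hL⟩ := hroot (γ j).toNat
    have hj := hnn γ hγ j
    simp only [Pi.zero_apply] at hj
    set q : Polynomial K := aeval (fun l => Polynomial.C (γ l : K) + Polynomial.C (d l : K) * Polynomial.X) c with hq
    have hqe : ∀ t, q.eval t = eval (fun l => (γ l : K) + d l * t) c := fun t => by
      rw [hq, eval_line]; simp
    have h1 := eq_C_of_comp_eq_zero (rootPoly_monic L).ne_zero (q := q) (fun s => by
      have h2 := hL (γ + (s : ℤ) • d) (fun l => (hγ l).trans (by
        have : 0 ≤ (s : ℤ) * d l := mul_nonneg (Int.natCast_nonneg s) (hd l)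
        simp only [Pi.add_apply, Pi.smul_apply, smul_eq_mul]; omega)) (by
          simp [hdj, Int.toNat_of_nonneg hj])
      rw [hqe, ← h2]
      congr 3
      funext l
      simp [mul_comm]) 1 0
    rw [hqe, hqe] at h1
    simpa using h1
  set D : Polynomial K := aeval (fun _ => Polynomial.X) c with hD
  have hDe : ∀ t, D.eval t = eval (fun _ => t) c := fun t => by rw [hD, eval_line]; simp
  have hcD : ∀ γ : Fin n → ℤ, (∀ l, (N : ℤ) ≤ γ l) → eval (fun l => (γ l : K)) c = D.eval (γ j : K) := by
    intro γ hγ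
    -- The pointwise maximum of `γ` and the constant vector `γ j` is reached from both by
    -- nonnegative moves that fix the `j`-th entry.
    have h1 := hadd γ (fun l => max (γ l) (γ j) - γ l) hγ (fun l => by simp) (by simp)
    have h2 := hadd (fun _ => γ j) (fun l => max (γ l) (γ j) - γ j) (fun _ => hγ j) (fun l => by simp)
      (by simp)
    rw [hDe, ← h1, ← h2]
    congr 2
    funext l
    simp
  have hpos : ∀ t : ℤ, (N : ℤ) ≤ t → ∃ k : ℕ, D.eval (t : K) = (k : K) + 1 := by
    intro t ht
    obtain ⟨L, hL⟩ := hroot t.toNat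
    have h1 := hL (fun _ => t) (fun _ => ht) (by omega)
    rw [rootPoly_eval_eq_zero_iff] at h1
    obtain ⟨k, -, hk⟩ := h1
    exact ⟨k, by rw [hDe]; exact hk⟩
  obtain ⟨B, f, p, M, hrep, hp⟩ := exists_corner_rep ((h.mem_iff _).2 (del_mem (K := K) i))
  obtain ⟨C, hC⟩ := exists_band_bound B
  -- `∂_i ∫_i = 1` prevents `Φ(∂_i)` from vanishing on the far corner, so some shift `β` has a
  -- nonzero coefficient there.
  have hYneg : ¬ NegOn Finset.univ (Φ (del K n i)) := by
    intro hY
    have := hY.mul_right (mem_jacobianAlg ((h.mem_iff _).2 (integ_mem (K := K) i)))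
    rw [← map_mul, del_mul_integ, map_one] at this
    exact not_negOn_univ_one this
  obtain ⟨γ, hγ0, hγ, hne⟩ : ∃ γ, 0 ≤ γ ∧ (∀ l ∈ Finset.univ, ((N + M + C : ℕ) : ℤ) ≤ γ l) ∧
      Φ (del K n i) (dp K n γ) ≠ 0 := by
    by_contra! hcon
    exact hYneg ⟨N + M + C, hcon⟩
  rw [hrep γ hγ0] at hne
  obtain ⟨β, hβ, hne⟩ := Finset.exists_ne_zero_of_sum_ne_zero hne
  have hfβ : f β γ ≠ 0 := fun h0 => hne (by rw [h0, zero_smul])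
  have hγ' : ∀ l, (N : ℤ) + M + C ≤ γ l := fun l => by
    have := hγ l (Finset.mem_univ l)
    push_cast at this
    exact this
  set q : Polynomial K := aeval (fun l => Polynomial.C (γ l : K) + Polynomial.X) (p β) with hq
  have hqe : ∀ t, q.eval t = eval (fun l => (γ l : K) + t) (p β) := fun t => by
    rw [hq, eval_line]; simp
  have hq0 : q ≠ 0 := by
    intro hz
    have := hqe 0
    rw [hz, Polynomial.eval_zero] at this
    apply hfβ
    rw [hp β hβ γ (fun l => by have := hγ' l; omega), this]
    simp
  have hcomm := congrArg Φ (del_mul_opH_sub (K := K) i)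
  rw [map_sub, map_mul, map_mul, ← hX] at hcomm
  -- The coefficient of the shift `β` in the image of `∂H - H∂ = ∂`, read along the diagonal through
  -- `γ`, which stays in the corner.
  have hs : ∀ s : ℕ, q.eval (s : K) *
      (D.eval ((γ j : K) + s) - D.eval ((γ j : K) + s + (β j : K)) - 1) = 0 := by
    intro s
    set δ : Fin n → ℤ := fun l => γ l + s with hδ
    have hδN : ∀ l, (N : ℤ) + M + C ≤ δ l := fun l => by have := hγ' l; simp only [hδ]; omega
    have hδ0 : 0 ≤ δ := hnn δ fun l => by have := hδN l; omega
    have h1 : Φ (del K n i) (X (dp K n δ)) - X (Φ (del K n i) (dp K n δ)) = Φ (del K n i) (dp K n δ) := by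
      have := LinearMap.congr_fun hcomm (dp K n δ)
      simpa using this
    have hδβ : ∀ β' ∈ B, ∀ l, (N : ℤ) ≤ (δ + β') l := fun β' hβ' l => by
      have := hδN l
      have := (hC β' hβ' l).1
      simp only [Pi.add_apply]
      omega
    have h2 : X (Φ (del K n i) (dp K n δ))
        = ∑ β' ∈ B, (f β' δ * eval (fun l => ((δ + β') l : K)) c) • dp K n (δ + β') := by
      rw [hrep δ hδ0, map_sum]
      exact Finset.sum_congr rfl fun β' hβ' => by rw [map_smul, hc _ (hδβ β' hβ'), smul_smul]
    rw [h2, hc δ (fun l => by have := hδN l; omega), map_smul, hrep δ hδ0, Finset.smul_sum,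
      ← Finset.sum_sub_distrib] at h1
    have h3 := congrArg (cf K n (δ + β)) h1
    have hcoef : ∀ g : (Fin n → ℤ) → K, cf K n (δ + β) (∑ β' ∈ B, g β' • dp K n (δ + β')) = g β := by
      intro g
      rw [map_sum, Finset.sum_eq_single_of_mem β hβ]
      · rw [map_smul, cf_dp_self (hnn _ (hδβ β hβ)), smul_eq_mul, mul_one]
      · intro β' hβ' hne'
        rw [map_smul, cf_dp (hnn _ (hδβ β' hβ')), if_neg, smul_zero]
        exact fun e => hne' (add_left_cancel e).symm
    simp only [smul_smul, ← sub_smul] at h3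
    rw [hcoef, hcoef, hcD δ (fun l => by have := hδN l; omega), hcD _ (hδβ β hβ),
      hp β hβ δ (fun l => by have := hδN l; omega)] at h3
    have e1 : eval (fun l => (δ l : K)) (p β) = q.eval (s : K) := by
      rw [hqe]
      congr 2
      funext l
      simp [hδ]
    have e2 : (δ j : K) = (γ j : K) + s := by simp [hδ]
    have e3 : (((δ + β) j : ℤ) : K) = (γ j : K) + s + β j := by simp [hδ]
    rw [e1, e2, e3] at h3
    linear_combination h3
  have hprod : q * (D.comp (Polynomial.C (γ j : K) + Polynomial.X)
      - D.comp (Polynomial.C (γ j : K) + Polynomial.X + Polynomial.C (β j : K)) - 1) = 0 := by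
    refine Polynomial.eq_zero_of_infinite_isRoot _ ?_
    refine (Set.infinite_range_of_injective (Nat.cast_injective (R := K))).mono ?_
    rintro _ ⟨s, rfl⟩
    have := hs s
    simpa [Polynomial.IsRoot] using this
  have hdiff0 := (mul_eq_zero.1 hprod).resolve_left hq0
  have hdiff : ∀ t : K, D.eval t - D.eval (t + (β j : ℤ)) = 1 := by
    intro t
    have := congrArg (Polynomial.eval (t - γ j)) hdiff0
    simp only [Polynomial.eval_sub, Polynomial.eval_comp, Polynomial.eval_add, Polynomial.eval_C,
      Polynomial.eval_X, Polynomial.eval_one, Polynomial.eval_zero, add_sub_cancel] at this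
    exact sub_eq_zero.1 this
  obtain ⟨b, hb⟩ := exists_eq_add_of_difference_eq hpos hdiff
  exact ⟨b, N, fun γ hγ => by rw [hc γ hγ, hcD γ hγ, hb]⟩

theorem Normalizes.opHInv_map_mem {Φ : EndP K n ≃ₐ[K] EndP K n} (h : Normalizes Φ) (i : Fin n) :
    Φ (opHInv K n i) ∈ jacobianAlg K n := by
  obtain ⟨j, hij⟩ := h.symm.exists_mapsPrime i
  obtain ⟨b, N, hb⟩ := h.exists_shift hij
  -- `(H_j + a)_*` has eigenvalue `γ j + 1 + a` at large exponents, so `γ j + b` corresponds to `a =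
  -- b - 1`.
  obtain ⟨G, hG, hGdp⟩ := exists_hStar_inverse (K := K) j (b - 1)
  obtain ⟨G', hG', he⟩ := exists_right_inverse h i ⟨G, hG, N + b.natAbs + 1, fun γ hγ hN => by
    have hN' : ∀ l, (N : ℤ) + b.natAbs + 1 ≤ γ l := fun l => by
      have := hN l (Finset.mem_univ l)
      push_cast at *
      exact this
    have hne : γ j + b ≠ 0 := by have := hN' j; omega
    have e : γ j + 1 + (b - 1) = γ j + b := by ring
    rw [LinearMap.sub_apply, Module.End.mul_apply, hGdp γ hγ, map_smul,
      hb γ (fun l => by have := hN' l; omega), smul_smul, e, star, if_neg hne, Int.cast_add,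
      inv_mul_cancel₀ (by exact_mod_cast hne), one_smul, Module.End.one_apply, sub_self]⟩
  have h1 : Φ (opHInv K n i) = G' := by
    calc Φ (opHInv K n i) = Φ (opHInv K n i) * (Φ (opH K n i) * G') := by rw [he, mul_one]
      _ = G' := by rw [← mul_assoc, ← map_mul, opHInv_mul_opH, map_one, one_mul]
  rw [h1]
  exact hG'

/-! ### Automorphisms of `I_n` as conjugations -/

theorem exists_matUnit_pair {α β : Fin n → ℤ} (hα : 0 ≤ α) (hβ : 0 ≤ β) :
    ∃ r ∈ intDiffAlg K n, ∀ p, r p = cf K n β p • dp K n α := by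
  obtain ⟨r, hr, h⟩ := exists_matUnit_prod (K := K) Finset.univ (fun i => (β i).toNat)
    (fun i => (α i).toNat)
  refine ⟨r, hr, fun p => ?_⟩
  have e : r = (cf K n β).smulRight (dp K n α) := by
    refine end_ext fun γ hγ => ?_
    rw [h γ hγ, LinearMap.smulRight_apply, cf_dp hγ]
    have h1 : (∀ i ∈ Finset.univ, γ i = (β i).toNat) ↔ β = γ := by
      rw [funext_iff]
      refine ⟨fun h i => ?_, fun h i _ => ?_⟩
      · rw [h i (Finset.mem_univ i), Int.toNat_of_nonneg (hβ i)]
      · rw [← h i, Int.toNat_of_nonneg (hβ i)]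
    simp only [h1]
    split_ifs
    · rw [one_smul]
      congr 1
      funext i
      simpa using hα i
    · rw [zero_smul]
  rw [e, LinearMap.smulRight_apply]

/-- Rank-one operators in `I_n` send a vector with a nonzero coordinate to a nonzero multiple of any
chosen basis vector. -/
theorem eq_bot_or_eq_top_of_stable (W : Submodule K (MvPolynomial (Fin n) K))
    (hW : ∀ a ∈ intDiffAlg K n, ∀ w ∈ W, a w ∈ W) : W = ⊥ ∨ W = ⊤ := by
  refine or_iff_not_imp_left.2 fun hne => ?_
  obtain ⟨w, hw, hw0⟩ := Submodule.exists_mem_ne_zero_of_ne_bot hne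
  obtain ⟨γ, hγ, hcf⟩ : ∃ γ, 0 ≤ γ ∧ cf K n γ w ≠ 0 := by
    by_contra! hc
    exact hw0 (poly_ext fun γ hγ => by rw [hc γ hγ, map_zero])
  rw [eq_top_iff, ← span_range_dp, Submodule.span_le]
  rintro _ ⟨δ, hδ, rfl⟩
  obtain ⟨r, hr, h⟩ := exists_matUnit_pair (K := K) hδ hγ
  have := hW r hr w hw
  rw [h] at this
  exact (Submodule.smul_mem_iff _ hcf).1 this

theorem lmul_mem_intDiffAlg (p : MvPolynomial (Fin n) K) :
    Algebra.lmul K (MvPolynomial (Fin n) K) p ∈ intDiffAlg K n := by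
  induction p using MvPolynomial.induction_on with
  | C a =>
    rw [← MvPolynomial.algebraMap_eq, AlgHom.commutes]
    exact Subalgebra.algebraMap_mem _ a
  | add p q hp hq => rw [map_add]; exact add_mem hp hq
  | mul_X p i hp => rw [map_mul]; exact mul_mem hp (mulX_mem i)

theorem dp_zero : dp K n 0 = 1 := by
  have := dp_eq_monomial (K := K) (0 : Fin n → ℕ)
  have e : (fun i => (((0 : Fin n → ℕ) i : ℕ) : ℤ)) = 0 := by funext i; simp
  rw [e] at this
  rw [this]
  have e2 : Finsupp.equivFunOnFinite.symm (0 : Fin n → ℕ) = 0 := by ext; simp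
  rw [e2]
  simp

/-- Every automorphism of `I_n` is the conjugation by a linear automorphism of `P_n`. -/
theorem exists_conj (σ : intDiffAlg K n ≃ₐ[K] intDiffAlg K n) :
    ∃ φ : MvPolynomial (Fin n) K ≃ₗ[K] MvPolynomial (Fin n) K,
      ∀ (a : intDiffAlg K n) p, φ ((a : EndP K n) p) = (σ a : EndP K n) (φ p) := by
  obtain ⟨e₀, he₀, hedp⟩ := exists_matUnit_pair (K := K) (n := n) (le_refl (0 : Fin n → ℤ)) le_rfl
  rw [dp_zero] at hedp
  let e : intDiffAlg K n := ⟨e₀, he₀⟩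
  have hcf1 : cf K n 0 1 = 1 := by rw [← dp_zero, cf_dp_self le_rfl]
  have hee : e * e = e := by
    refine Subtype.ext (LinearMap.ext fun p => ?_)
    change e₀ (e₀ p) = e₀ p
    rw [hedp p, map_smul, hedp 1, hcf1, one_smul]
  have he1 : e₀ 1 = 1 := by rw [hedp, hcf1, one_smul]
  have hσe : (σ e : EndP K n) ≠ 0 := by
    intro h
    have h1 : σ e = 0 := Subtype.ext h
    have h2 : e = 0 := σ.injective (h1.trans (map_zero σ).symm)
    have h3 : e₀ = 0 := congrArg Subtype.val h2
    rw [h3, LinearMap.zero_apply] at he1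
    exact zero_ne_one he1
  obtain ⟨w, hw⟩ : ∃ w, (σ e : EndP K n) w ≠ 0 := by
    by_contra! h
    exact hσe (LinearMap.ext h)
  -- A nonzero vector fixed by `σ e`; it plays the role of `1`, which spans the range of the
  -- rank-one idempotent `e`.
  set v := (σ e : EndP K n) w with hv
  have hev : (σ e : EndP K n) v = v := by
    rw [hv, ← Module.End.mul_apply, ← Subalgebra.coe_mul, ← map_mul, hee]
  let m : MvPolynomial (Fin n) K →ₐ[K] intDiffAlg K n :=
    (Algebra.lmul K (MvPolynomial (Fin n) K)).codRestrict _ lmul_mem_intDiffAlg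
  let φ : MvPolynomial (Fin n) K →ₗ[K] MvPolynomial (Fin n) K :=
    { toFun := fun p => (σ (m p) : EndP K n) v
      map_add' := fun p q => by rw [map_add, map_add]; rfl
      map_smul' := fun c p => by rw [map_smul, map_smul]; rfl }
  have hφ : ∀ (a : intDiffAlg K n) p, φ ((a : EndP K n) p) = (σ a : EndP K n) (φ p) := by
    intro a p
    -- The range of `e` consists of constants, on which `a` after multiplication by `p` is
    -- multiplication by `a p`.
    have h1 : m ((a : EndP K n) p) * e = a * m p * e := by
      refine Subtype.ext (LinearMap.ext fun x => ?_)
      change (a : EndP K n) p * e₀ x = (a : EndP K n) (p * e₀ x)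
      rw [hedp, mul_smul_comm, mul_smul_comm, mul_one, mul_one, map_smul]
    change (σ (m ((a : EndP K n) p)) : EndP K n) v = (σ a : EndP K n) ((σ (m p) : EndP K n) v)
    have h2 : ∀ x : intDiffAlg K n, (σ x : EndP K n) v = (σ (x * e) : EndP K n) v := fun x => by
      rw [map_mul, Subalgebra.coe_mul, Module.End.mul_apply, hev]
    rw [h2, h1, ← h2, map_mul, Subalgebra.coe_mul, Module.End.mul_apply]
  have hφ1 : φ 1 = v := by
    change (σ (m 1) : EndP K n) v = v
    rw [map_one, map_one]
    rfl
  have hker : LinearMap.ker φ = ⊥ := by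
    refine (eq_bot_or_eq_top_of_stable _ fun a ha p hp => ?_).resolve_right fun h => ?_
    · rw [LinearMap.mem_ker] at hp ⊢
      rw [hφ ⟨a, ha⟩ p, hp, map_zero]
    · have h1 : (1 : MvPolynomial (Fin n) K) ∈ LinearMap.ker φ := by rw [h]; trivial
      rw [LinearMap.mem_ker, hφ1] at h1
      exact hw h1
  have hrange : LinearMap.range φ = ⊤ := by
    refine (eq_bot_or_eq_top_of_stable _ fun a ha p hp => ?_).resolve_left fun h => ?_
    · obtain ⟨q, rfl⟩ := hp
      refine ⟨(σ.symm ⟨a, ha⟩ : EndP K n) q, ?_⟩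
      rw [hφ, σ.apply_symm_apply]
    · have h1 : φ 1 ∈ LinearMap.range φ := ⟨1, rfl⟩
      rw [h, hφ1] at h1
      exact hw ((Submodule.mem_bot K).1 h1)
  exact ⟨LinearEquiv.ofBijective φ ⟨LinearMap.ker_eq_bot.1 hker, LinearMap.range_eq_top.1 hrange⟩, hφ⟩

theorem exists_normalizes (σ : intDiffAlg K n ≃ₐ[K] intDiffAlg K n) :
    ∃ Φ : EndP K n ≃ₐ[K] EndP K n, Normalizes Φ ∧ ∀ a : intDiffAlg K n, Φ a = σ a := by
  obtain ⟨φ, hφ⟩ := exists_conj σ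
  have hσ : ∀ a : intDiffAlg K n, φ.conjAlgEquiv K (a : EndP K n) = σ a := by
    intro a
    refine LinearMap.ext fun p => ?_
    rw [LinearEquiv.conjAlgEquiv_apply]
    change φ ((a : EndP K n) (φ.symm p)) = _
    rw [hφ, φ.apply_symm_apply]
  refine ⟨φ.conjAlgEquiv K, ⟨fun a => ⟨fun h => ?_, fun h => ?_⟩, fun a => ?_⟩, hσ⟩
  · have h1 := hσ (σ.symm ⟨_, h⟩)
    rw [σ.apply_symm_apply] at h1
    rw [← (φ.conjAlgEquiv K).injective h1]
    exact Subtype.property _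
  · rw [hσ ⟨a, h⟩]
    exact Subtype.property _
  · have e : LinearMap.range (φ.conjAlgEquiv K a) = (LinearMap.range a).map φ.toLinearMap := by
      rw [LinearEquiv.conjAlgEquiv_apply, LinearMap.range_comp, LinearMap.range_comp,
        LinearEquiv.range, Submodule.map_top]
    rw [e]
    exact ⟨fun h => (φ.submoduleMap (LinearMap.range a)).symm.finiteDimensional,
      fun h => (φ.submoduleMap (LinearMap.range a)).finiteDimensional⟩

/-! ### Existence and uniqueness of the extension to `A_n` -/

theorem Normalizes.map_jacobianAlg_le {Φ : EndP K n ≃ₐ[K] EndP K n} (h : Normalizes Φ) :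
    (jacobianAlg K n).map (Φ : EndP K n →ₐ[K] EndP K n) ≤ jacobianAlg K n := by
  rw [Subalgebra.map_le]
  refine Algebra.adjoin_le ?_
  rintro _ ((⟨i, rfl⟩ | ⟨i, rfl⟩) | ⟨i, rfl⟩)
  · exact mem_jacobianAlg ((h.mem_iff _).2 (mulX_mem i))
  · exact mem_jacobianAlg ((h.mem_iff _).2 (del_mem i))
  · exact h.opHInv_map_mem i

theorem Normalizes.map_jacobianAlg {Φ : EndP K n ≃ₐ[K] EndP K n} (h : Normalizes Φ) :
    (jacobianAlg K n).map (Φ : EndP K n →ₐ[K] EndP K n) = jacobianAlg K n := by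
  refine le_antisymm h.map_jacobianAlg_le fun a ha => ?_
  exact ⟨Φ.symm a, h.symm.map_jacobianAlg_le ⟨a, ha, rfl⟩, Φ.apply_symm_apply a⟩

theorem coe_incl (a : intDiffAlg K n) : (incl K n a : EndP K n) = a :=
  Subalgebra.coe_inclusion (intDiffAlg_le_jacobianAlg K n) a

theorem Normalizes.exists_restrict {Φ : EndP K n ≃ₐ[K] EndP K n} (h : Normalizes Φ) :
    ∃ τ : jacobianAlg K n ≃ₐ[K] jacobianAlg K n, ∀ x, (τ x : EndP K n) = Φ (x : EndP K n) :=
  ⟨(Φ.subalgebraMap (jacobianAlg K n)).trans (Subalgebra.equivOfEq _ _ h.map_jacobianAlg),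
    fun _ => rfl⟩

theorem exists_extension (σ : intDiffAlg K n ≃ₐ[K] intDiffAlg K n) :
    ∃ τ : jacobianAlg K n ≃ₐ[K] jacobianAlg K n, ∀ a, τ (incl K n a) = incl K n (σ a) := by
  obtain ⟨Φ, h, hσ⟩ := exists_normalizes σ
  obtain ⟨τ, hτ⟩ := h.exists_restrict
  exact ⟨τ, fun a => Subtype.ext (by rw [hτ, coe_incl, coe_incl, hσ])⟩

theorem extension_unique {τ τ' : jacobianAlg K n ≃ₐ[K] jacobianAlg K n}
    (h : ∀ a, τ (incl K n a) = τ' (incl K n a)) : τ = τ' := by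
  refine AlgEquiv.ext fun ⟨a, ha⟩ => ?_
  induction ha using Algebra.adjoin_induction with
  | mem x hx =>
    rcases hx with (⟨i, rfl⟩ | ⟨i, rfl⟩) | ⟨i, rfl⟩
    · exact h ⟨_, mulX_mem i⟩
    · exact h ⟨_, del_mem i⟩
    · have h1 : (incl K n ⟨_, opH_mem i⟩) * (⟨opHInv K n i, opHInv_mem i⟩ : jacobianAlg K n) = 1 :=
        Subtype.ext (opH_mul_opHInv K n i)
      have h2 : (⟨opHInv K n i, opHInv_mem i⟩ : jacobianAlg K n) * (incl K n ⟨_, opH_mem i⟩) = 1 :=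
        Subtype.ext (opHInv_mul_opH K n i)
      have h3 := congrArg τ h2
      have h4 := congrArg τ' h1
      rw [map_mul, map_one] at h3 h4
      rw [h] at h3
      -- The images of `H_i⁻¹` under both maps are inverse to the common image of `H_i`.
      exact left_inv_eq_right_inv h3 h4
  | algebraMap r => exact (τ.commutes r).trans (τ'.commutes r).symm
  | add x y hx hy h1 h2 =>
    have := congrArg₂ (· + ·) h1 h2
    simp only [← map_add] at this
    exact this
  | mul x y hx hy h1 h2 =>
    have := congrArg₂ (· * ·) h1 h2
    simp only [← map_mul] at this
    exact this

/-! ### Ore conditions and the localization -/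

theorem shiftOp_mul_hStar (β : Fin n → ℤ) (f : (Fin n → ℤ) → K) (k : Fin n) (a : ℤ) :
    shiftOp β f * hStar K n k (a + β k) = hStar K n k a * shiftOp β f := by
  refine end_ext fun γ hγ => ?_
  rw [Module.End.mul_apply, Module.End.mul_apply, hStar_dp k _ hγ, map_smul, shiftOp_dp _ _ hγ,
    map_smul]
  by_cases h : 0 ≤ γ + β
  · rw [hStar_dp k _ h, smul_comm, Pi.add_apply]
    congr 3
    ring
  · rw [dp_of_not_nonneg h, map_zero, smul_zero, smul_zero]

/-- The elements of `S`, as operators on `P_n`. -/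
def opS (K : Type*) [Field K] (n : ℕ) : Submonoid (EndP K n) :=
  Submonoid.closure (Set.range fun p : Fin n × ℤ => hStar K n p.1 p.2)

theorem map_monoidS : (monoidS K n).map (intDiffAlg K n).val.toMonoidHom = opS K n := by
  rw [monoidS, opS, MonoidHom.map_mclosure, ← Set.range_comp]
  rfl

theorem opS_le {s : EndP K n} (hs : s ∈ opS K n) : s ∈ intDiffAlg K n := by
  rw [← map_monoidS] at hs
  obtain ⟨x, -, rfl⟩ := hs
  exact x.2

theorem mk_mem_monoidS {s : EndP K n} (hs : s ∈ opS K n) : (⟨s, opS_le hs⟩ : intDiffAlg K n) ∈ monoidS K n := by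
  have h := hs
  rw [← map_monoidS] at h
  obtain ⟨x, hx, hxs⟩ := h
  have : (⟨s, opS_le hs⟩ : intDiffAlg K n) = x := Subtype.ext hxs.symm
  rwa [this]

theorem opS_comm {s t : EndP K n} (hs : s ∈ opS K n) (ht : t ∈ opS K n) : s * t = t * s := by
  have key : ∀ s ∈ opS K n, ∃ u : (Fin n → ℤ) → K, s = shiftOp 0 u := by
    intro s hs
    induction hs using Submonoid.closure_induction with
    | mem x hx =>
      obtain ⟨⟨i, a⟩, rfl⟩ := hx
      exact ⟨fun γ => star K (γ i + 1 + a), end_ext fun γ hγ => by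
        rw [shiftOp_dp _ _ hγ, add_zero]; exact hStar_dp i a hγ⟩
    | one => exact ⟨1, end_ext fun γ hγ => by rw [shiftOp_dp _ _ hγ, add_zero]; simp⟩
    | mul x y _ _ hx hy =>
      obtain ⟨u, rfl⟩ := hx
      obtain ⟨w, rfl⟩ := hy
      exact ⟨_, (shiftOp_mul _ _ _ _).trans (by rw [add_zero])⟩
  obtain ⟨u, rfl⟩ := key s hs
  obtain ⟨w, rfl⟩ := key t ht
  refine end_ext fun γ hγ => ?_
  simp only [Module.End.mul_apply, shiftOp_dp _ _ hγ, map_smul, add_zero]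
  exact smul_comm _ _ _

theorem exists_inverse_of_mem_opS {s : EndP K n} (hs : s ∈ opS K n) :
    ∃ G ∈ jacobianAlg K n, G * s = 1 ∧ s * G = 1 := by
  induction hs using Submonoid.closure_induction with
  | mem x hx =>
    obtain ⟨⟨i, a⟩, rfl⟩ := hx
    obtain ⟨G, hG, h⟩ := exists_hStar_inverse (K := K) i a
    refine ⟨G, hG, end_ext fun γ hγ => ?_, end_ext fun γ hγ => ?_⟩
    · rw [Module.End.mul_apply, hStar_dp i a hγ, map_smul, h γ hγ, smul_smul,
        mul_inv_cancel₀ (star_ne_zero _), one_smul, Module.End.one_apply]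
    · rw [Module.End.mul_apply, h γ hγ, map_smul, hStar_dp i a hγ, smul_smul,
        inv_mul_cancel₀ (star_ne_zero _), one_smul, Module.End.one_apply]
  | one => exact ⟨1, one_mem _, one_mul 1, one_mul 1⟩
  | mul x y _ _ hx hy =>
    obtain ⟨G, hG, h1, h2⟩ := hx
    obtain ⟨G', hG', h3, h4⟩ := hy
    refine ⟨G' * G, mul_mem hG' hG, ?_, ?_⟩
    · rw [mul_assoc, ← mul_assoc G, h1, one_mul, h3]
    · rw [mul_assoc, ← mul_assoc y, h4, one_mul, h2]

theorem shiftOp_mul_opS (β : Fin n → ℤ) (f : (Fin n → ℤ) → K) {s : EndP K n} (hs : s ∈ opS K n) :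
    ∃ s' ∈ opS K n, s' * shiftOp β f = shiftOp β f * s := by
  induction hs using Submonoid.closure_induction with
  | mem x hx =>
    obtain ⟨⟨i, a⟩, rfl⟩ := hx
    refine ⟨_, Submonoid.subset_closure ⟨(i, a - β i), rfl⟩, ?_⟩
    have := shiftOp_mul_hStar β f i (a - β i)
    rw [sub_add_cancel] at this
    exact this.symm
  | one => exact ⟨1, one_mem _, by rw [one_mul, mul_one]⟩
  | mul x y _ _ hx hy =>
    obtain ⟨x', hx', h1⟩ := hx
    obtain ⟨y', hy', h2⟩ := hy
    exact ⟨x' * y', mul_mem hx' hy', by rw [mul_assoc, h2, ← mul_assoc, h1, mul_assoc]⟩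

theorem opS_mul_shiftOp (β : Fin n → ℤ) (f : (Fin n → ℤ) → K) {s : EndP K n} (hs : s ∈ opS K n) :
    ∃ s' ∈ opS K n, shiftOp β f * s' = s * shiftOp β f := by
  induction hs using Submonoid.closure_induction with
  | mem x hx =>
    obtain ⟨⟨i, a⟩, rfl⟩ := hx
    exact ⟨_, Submonoid.subset_closure ⟨(i, a + β i), rfl⟩, shiftOp_mul_hStar β f i a⟩
  | one => exact ⟨1, one_mem _, by rw [one_mul, mul_one]⟩
  | mul x y _ _ hx hy =>
    obtain ⟨x', hx', h1⟩ := hx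
    obtain ⟨y', hy', h2⟩ := hy
    exact ⟨x' * y', mul_mem hx' hy', by rw [← mul_assoc, h1, mul_assoc, h2, mul_assoc]⟩

/-- A generator is a single shift and passes denominators with `r' = r`. Sums use commutativity of
`S` to form a common denominator; products pass denominators one factor at a time. -/
theorem exists_left_ore {r : EndP K n} (hr : r ∈ intDiffAlg K n) :
    ∀ s ∈ opS K n, ∃ s' ∈ opS K n, ∃ r' ∈ intDiffAlg K n, s' * r = r' * s := by
  induction hr using Algebra.adjoin_induction with
  | mem x hx =>
    intro s hs
    have hx' : x ∈ intDiffAlg K n := Algebra.subset_adjoin hx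
    obtain ⟨β, f, rfl⟩ : ∃ β f, x = shiftOp β f := by
      rcases hx with (⟨i, rfl⟩ | ⟨i, rfl⟩) | ⟨i, rfl⟩
      exacts [⟨_, _, mulX_eq_shiftOp i⟩, ⟨_, _, del_eq_shiftOp i⟩, ⟨_, _, integ_eq_shiftOp i⟩]
    obtain ⟨s', hs', h⟩ := shiftOp_mul_opS β f hs
    exact ⟨s', hs', _, hx', h⟩
  | algebraMap c =>
    exact fun s hs => ⟨s, hs, _, Subalgebra.algebraMap_mem _ c, (Algebra.commutes c s).symm⟩
  | add x y _ _ hx hy =>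
    intro s hs
    obtain ⟨s₁, hs₁, r₁, hr₁, h₁⟩ := hx s hs
    obtain ⟨s₂, hs₂, r₂, hr₂, h₂⟩ := hy s hs
    refine ⟨s₁ * s₂, mul_mem hs₁ hs₂, s₂ * r₁ + s₁ * r₂,
      add_mem (mul_mem (opS_le hs₂) hr₁) (mul_mem (opS_le hs₁) hr₂), ?_⟩
    rw [mul_add, add_mul, mul_assoc s₂, ← h₁, mul_assoc s₁ r₂, ← h₂, ← mul_assoc s₂,
      opS_comm hs₂ hs₁, mul_assoc s₁ s₂ y]
  | mul x y _ _ hx hy =>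
    intro s hs
    obtain ⟨s₂, hs₂, r₂, hr₂, h₂⟩ := hy s hs
    obtain ⟨s₁, hs₁, r₁, hr₁, h₁⟩ := hx s₂ hs₂
    exact ⟨s₁, hs₁, r₁ * r₂, mul_mem hr₁ hr₂, by rw [← mul_assoc, h₁, mul_assoc, h₂, mul_assoc]⟩

theorem exists_right_ore {r : EndP K n} (hr : r ∈ intDiffAlg K n) :
    ∀ s ∈ opS K n, ∃ s' ∈ opS K n, ∃ r' ∈ intDiffAlg K n, r * s' = s * r' := by
  induction hr using Algebra.adjoin_induction with
  | mem x hx =>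
    intro s hs
    have hx' : x ∈ intDiffAlg K n := Algebra.subset_adjoin hx
    obtain ⟨β, f, rfl⟩ : ∃ β f, x = shiftOp β f := by
      rcases hx with (⟨i, rfl⟩ | ⟨i, rfl⟩) | ⟨i, rfl⟩
      exacts [⟨_, _, mulX_eq_shiftOp i⟩, ⟨_, _, del_eq_shiftOp i⟩, ⟨_, _, integ_eq_shiftOp i⟩]
    obtain ⟨s', hs', h⟩ := opS_mul_shiftOp β f hs
    exact ⟨s', hs', _, hx', h⟩
  | algebraMap c =>
    exact fun s hs => ⟨s, hs, _, Subalgebra.algebraMap_mem _ c, Algebra.commutes c s⟩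
  | add x y _ _ hx hy =>
    intro s hs
    obtain ⟨s₁, hs₁, r₁, hr₁, h₁⟩ := hx s hs
    obtain ⟨s₂, hs₂, r₂, hr₂, h₂⟩ := hy s hs
    refine ⟨s₁ * s₂, mul_mem hs₁ hs₂, r₁ * s₂ + r₂ * s₁,
      add_mem (mul_mem hr₁ (opS_le hs₂)) (mul_mem hr₂ (opS_le hs₁)), ?_⟩
    rw [add_mul, mul_add, ← mul_assoc s, ← h₁, ← mul_assoc s, ← h₂, mul_assoc, mul_assoc y,
      opS_comm hs₂ hs₁]
  | mul x y _ _ hx hy =>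
    intro s hs
    obtain ⟨s₁, hs₁, r₁, hr₁, h₁⟩ := hx s hs
    obtain ⟨s₂, hs₂, r₂, hr₂, h₂⟩ := hy s₁ hs₁
    exact ⟨s₂, hs₂, r₁ * r₂, mul_mem hr₁ hr₂, by rw [mul_assoc, h₂, ← mul_assoc, h₁, mul_assoc]⟩

theorem hStar_zero_mem_opS (i : Fin n) : opH K n i ∈ opS K n := by
  refine Submonoid.subset_closure ⟨(i, 0), ?_⟩
  change opH K n i + ((0 : ℕ) : EndP K n) = _
  rw [Nat.cast_zero, add_zero]

/-- The only generator needing a denominator is `H_i⁻¹`, cleared by `H_i = (H_i + 0)_*`. For a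
product `x y` the denominator of `y` is moved past `s₁ x` by the Ore condition. -/
theorem exists_left_denominator {q : EndP K n} (hq : q ∈ jacobianAlg K n) :
    ∃ s ∈ opS K n, s * q ∈ intDiffAlg K n := by
  induction hq using Algebra.adjoin_induction with
  | mem x hx =>
    rcases hx with (⟨i, rfl⟩ | ⟨i, rfl⟩) | ⟨i, rfl⟩
    · exact ⟨1, one_mem _, by rw [one_mul]; exact mulX_mem i⟩
    · exact ⟨1, one_mem _, by rw [one_mul]; exact del_mem i⟩
    · exact ⟨_, hStar_zero_mem_opS i, by rw [opH_mul_opHInv]; exact one_mem _⟩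
  | algebraMap c => exact ⟨1, one_mem _, by rw [one_mul]; exact Subalgebra.algebraMap_mem _ c⟩
  | add x y _ _ hx hy =>
    obtain ⟨s₁, hs₁, h₁⟩ := hx
    obtain ⟨s₂, hs₂, h₂⟩ := hy
    refine ⟨s₁ * s₂, mul_mem hs₁ hs₂, ?_⟩
    rw [mul_add, mul_assoc s₁ s₂ y, opS_comm hs₁ hs₂, mul_assoc]
    exact add_mem (mul_mem (opS_le hs₂) h₁) (mul_mem (opS_le hs₁) h₂)
  | mul x y _ _ hx hy =>
    obtain ⟨s₁, hs₁, h₁⟩ := hx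
    obtain ⟨s₂, hs₂, h₂⟩ := hy
    obtain ⟨s, hs, r, hr, h⟩ := exists_left_ore h₁ s₂ hs₂
    refine ⟨s * s₁, mul_mem hs hs₁, ?_⟩
    rw [← mul_assoc, mul_assoc s, h, mul_assoc]
    exact mul_mem hr h₂

theorem exists_right_denominator {q : EndP K n} (hq : q ∈ jacobianAlg K n) :
    ∃ s ∈ opS K n, q * s ∈ intDiffAlg K n := by
  induction hq using Algebra.adjoin_induction with
  | mem x hx =>
    rcases hx with (⟨i, rfl⟩ | ⟨i, rfl⟩) | ⟨i, rfl⟩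
    · exact ⟨1, one_mem _, by rw [mul_one]; exact mulX_mem i⟩
    · exact ⟨1, one_mem _, by rw [mul_one]; exact del_mem i⟩
    · exact ⟨_, hStar_zero_mem_opS i, by rw [opHInv_mul_opH]; exact one_mem _⟩
  | algebraMap c => exact ⟨1, one_mem _, by rw [mul_one]; exact Subalgebra.algebraMap_mem _ c⟩
  | add x y _ _ hx hy =>
    obtain ⟨s₁, hs₁, h₁⟩ := hx
    obtain ⟨s₂, hs₂, h₂⟩ := hy
    refine ⟨s₁ * s₂, mul_mem hs₁ hs₂, ?_⟩
    rw [add_mul, ← mul_assoc, opS_comm hs₁ hs₂, ← mul_assoc]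
    exact add_mem (mul_mem h₁ (opS_le hs₂)) (mul_mem h₂ (opS_le hs₁))
  | mul x y _ _ hx hy =>
    obtain ⟨s₁, hs₁, h₁⟩ := hx
    obtain ⟨s₂, hs₂, h₂⟩ := hy
    obtain ⟨s, hs, r, hr, h⟩ := exists_right_ore h₂ s₁ hs₁
    refine ⟨s₂ * s, mul_mem hs₂ hs, ?_⟩
    rw [mul_assoc x, ← mul_assoc y, h, ← mul_assoc]
    exact mul_mem h₁ hr

theorem isUnit_incl {s : intDiffAlg K n} (hs : s ∈ monoidS K n) : IsUnit (incl K n s) := by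
  have h : (s : EndP K n) ∈ opS K n := by
    rw [← map_monoidS]
    exact ⟨s, hs, rfl⟩
  obtain ⟨G, hG, h1, h2⟩ := exists_inverse_of_mem_opS h
  exact ⟨⟨incl K n s, ⟨G, hG⟩, Subtype.ext (by rw [Subalgebra.coe_mul, coe_incl]; exact h2),
    Subtype.ext (by rw [Subalgebra.coe_mul, coe_incl]; exact h1)⟩, rfl⟩

theorem incl_injective : Function.Injective (incl K n) := fun a b h =>
  Subtype.ext (by rw [← coe_incl a, h, coe_incl])

theorem isTwoSidedLocalization_incl :
    IsTwoSidedLocalization (R := intDiffAlg K n) (Q := jacobianAlg K n) (monoidS K n)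
      (incl K n).toRingHom where
  isUnit _ hs := isUnit_incl hs
  exists_left := by
    rintro ⟨q, hq⟩
    obtain ⟨s, hs, h⟩ := exists_left_denominator hq
    exact ⟨_, mk_mem_monoidS hs, ⟨_, h⟩, rfl⟩
  exists_right := by
    rintro ⟨q, hq⟩
    obtain ⟨s, hs, h⟩ := exists_right_denominator hq
    exact ⟨_, mk_mem_monoidS hs, ⟨_, h⟩, rfl⟩
  ker_left r := by
    refine ⟨fun h => ⟨1, one_mem _, ?_⟩, fun ⟨s, hs, h⟩ => ?_⟩
    · rw [one_mul]
      exact incl_injective (h.trans (map_zero (incl K n)).symm)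
    · have h1 := congrArg (incl K n) h
      rw [map_mul, map_zero] at h1
      exact (isUnit_incl hs).mul_right_eq_zero.1 h1
  ker_right r := by
    refine ⟨fun h => ⟨1, one_mem _, ?_⟩, fun ⟨s, hs, h⟩ => ?_⟩
    · rw [mul_one]
      exact incl_injective (h.trans (map_zero (incl K n)).symm)
    · have h1 := congrArg (incl K n) h
      rw [map_mul, map_zero] at h1
      exact (isUnit_incl hs).mul_left_eq_zero.1 h1

/-! ### The embedding of `Aut(I_n)` into `Aut(A_n)` and its image -/

/-- Extension of automorphisms from `I_n` to `A_n`. -/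
def extension (K : Type*) [Field K] [CharZero K] (n : ℕ) :
    (intDiffAlg K n ≃ₐ[K] intDiffAlg K n) →* (jacobianAlg K n ≃ₐ[K] jacobianAlg K n) where
  toFun σ := (exists_extension σ).choose
  map_one' := extension_unique fun a => (exists_extension 1).choose_spec a
  map_mul' σ σ' := extension_unique fun a => by
    rw [(exists_extension (σ * σ')).choose_spec a, AlgEquiv.mul_apply, AlgEquiv.mul_apply,
      (exists_extension σ').choose_spec a, (exists_extension σ).choose_spec]

theorem extension_incl (σ : intDiffAlg K n ≃ₐ[K] intDiffAlg K n) (a : intDiffAlg K n) :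
    extension K n σ (incl K n a) = incl K n (σ a) := (exists_extension σ).choose_spec a

theorem extension_injective : Function.Injective (extension K n) := fun σ σ' h =>
  AlgEquiv.ext fun a => incl_injective (by rw [← extension_incl, ← extension_incl, h])

theorem exists_restriction {τ : jacobianAlg K n ≃ₐ[K] jacobianAlg K n}
    (h : τ '' Set.range (incl K n) = Set.range (incl K n)) :
    ∃ σ : intDiffAlg K n ≃ₐ[K] intDiffAlg K n, ∀ a, τ (incl K n a) = incl K n (σ a) := by
  have h1 : ∀ a, ∃ b, incl K n b = τ (incl K n a) := fun a => by
    exact h.le (Set.mem_image_of_mem _ (Set.mem_range_self a))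
  choose g hg using h1
  have h2 : Function.Bijective g := by
    refine ⟨fun a b hab => ?_, fun b => ?_⟩
    · apply incl_injective
      apply τ.injective
      rw [← hg, ← hg, hab]
    · obtain ⟨_, ⟨a, rfl⟩, ha⟩ := h.ge (Set.mem_range_self b)
      exact ⟨a, incl_injective ((hg a).trans ha)⟩
  have hadd : ∀ a b, g (a + b) = g a + g b := fun a b => incl_injective (by
    rw [hg, map_add (incl K n), map_add (incl K n), map_add τ, hg, hg])
  have hmul : ∀ a b, g (a * b) = g a * g b := fun a b => incl_injective (by
    rw [hg, map_mul (incl K n), map_mul (incl K n), map_mul τ, hg, hg])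
  have hcomm : ∀ c : K, g (algebraMap K _ c) = algebraMap K _ c := fun c => incl_injective (by
    rw [hg, (incl K n).commutes, τ.commutes])
  let e : intDiffAlg K n ≃ intDiffAlg K n := Equiv.ofBijective g h2
  exact ⟨{ e with map_mul' := hmul, map_add' := hadd, commutes' := hcomm }, fun a => (hg a).symm⟩

theorem range_extension :
    ((extension K n).range : Set (jacobianAlg K n ≃ₐ[K] jacobianAlg K n)) =
      {τ : jacobianAlg K n ≃ₐ[K] jacobianAlg K n |
        τ '' Set.range (incl K n) = Set.range (incl K n)} := by
  ext τ
  constructor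
  · rintro ⟨σ, rfl⟩
    ext x
    constructor
    · rintro ⟨_, ⟨a, rfl⟩, rfl⟩
      exact ⟨σ a, (extension_incl σ a).symm⟩
    · rintro ⟨a, rfl⟩
      exact ⟨_, ⟨σ.symm a, rfl⟩, by rw [extension_incl, σ.apply_symm_apply]⟩
  · intro h
    obtain ⟨σ, hσ⟩ := exists_restriction h
    exact ⟨σ, extension_unique fun a => by rw [extension_incl, hσ]⟩

end
end IntDiff

theorem mainTheorem4 (K : Type*) [Field K] [CharZero K] (n : ℕ) :
    -- the Jacobian algebra is the two-sided localization of `I_n` at `S`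
    IntDiff.IsTwoSidedLocalization (R := IntDiff.intDiffAlg K n) (Q := IntDiff.jacobianAlg K n)
      (IntDiff.monoidS K n) (IntDiff.incl K n).toRingHom ∧
    -- every automorphism of `I_n` has a unique extension to an automorphism of `A_n`
    (∀ σ : IntDiff.intDiffAlg K n ≃ₐ[K] IntDiff.intDiffAlg K n,
      ∃! τ : IntDiff.jacobianAlg K n ≃ₐ[K] IntDiff.jacobianAlg K n,
        ∀ a : IntDiff.intDiffAlg K n, τ (IntDiff.incl K n a) = IntDiff.incl K n (σ a)) ∧
    -- extension embeds the group `Aut(I_n)` into `Aut(A_n)`, with image the set of all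
    -- `τ` such that `τ(I_n) = I_n`
    (∃ f : (IntDiff.intDiffAlg K n ≃ₐ[K] IntDiff.intDiffAlg K n) →*
          (IntDiff.jacobianAlg K n ≃ₐ[K] IntDiff.jacobianAlg K n),
      Function.Injective f ∧
      (∀ σ (a : IntDiff.intDiffAlg K n),
        f σ (IntDiff.incl K n a) = IntDiff.incl K n (σ a)) ∧
      (f.range : Set (IntDiff.jacobianAlg K n ≃ₐ[K] IntDiff.jacobianAlg K n)) =
        {τ : IntDiff.jacobianAlg K n ≃ₐ[K] IntDiff.jacobianAlg K n |
          τ '' Set.range (IntDiff.incl K n) = Set.range (IntDiff.incl K n)}) := by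
  exact ⟨IntDiff.isTwoSidedLocalization_incl,
    fun σ => ⟨IntDiff.extension K n σ, IntDiff.extension_incl σ, fun τ hτ =>
      IntDiff.extension_unique fun a => by rw [hτ, IntDiff.extension_incl]⟩,
    IntDiff.extension K n, IntDiff.extension_injective, IntDiff.extension_incl,
    IntDiff.range_extension⟩
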